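/- Graphs are finite and may have parallel edges but no loops; a graph is simple if it has no parallel edges. For a positive integer $r$, an $r$-regular graph $G$ is an \emph{$r$-graph} if $|\partial(S)|\ge r$ for every set $S\subseteq V(G)$ of odd cardinality, where $\partial(S)$ is the set of edges with precisely one end in $S$. For integers $r\ge 2$ and $i\ge 1$, let $T_i^r$ be the unique tree in which all vertex degrees are in $\{1,r\}$ and which has a vertex, called its root, at distance $i$ from every leaf. An automorphism of a graph $G$ is a permutation $\alpha$ of $V(G)$ such that for any two vertices $u,v$ the number of edges between $u$ and $v$ equals the number of edges between $\alpha(u)$ and $\alpha(v)$. An $r$-graph $G$ is a \emph{rotation $r$-graph} if, for some integer $i$, it has a spanning tree $T$ isomorphic to $T_i^r$ and an automorphism $\alpha$ that is also an automorphism of $T$, that fixes the root of $T$, and for which every other vertex $u$ satisfies $\min\{k\ge 1:\alpha^k(u)=u\}=r$. A \emph{nowhere-zero $k$-flow} of $G$ is an orientation of the edges of $G$ together with a map $f:E(G)\to\{\pm1,\dots,\pm(k-1)\}$ such that, at every vertex, the sum of $f$ over the incoming edges equals the sum of $f$ over the outgoing edges. \textbf{Corollary.} Every $5$-graph admits a nowhere-zero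 $3$-flow if and only if every simple rotation $5$-graph admits a nowhere-zero $3$-flow. -/

import Mathlib

universe u v

namespace Graph

variable {α : Type u} {β : Type v}

/-- The set `∂(S)` of edges of `G` with precisely one end in `S`. -/
def edgeBoundary (G : Graph α β) (S : Set α) : Set β :=
  {e | ∃ x ∈ S, ∃ y ∉ S, G.IsLink e x y}

/-- `G` is a finite `r`-regular graph, possibly with parallel edges, but without loops.
As there are no loops, the degree of `x` is the number of edges incident with `x`. -/
structure IsRegularMultigraph (r : ℕ) (G : Graph α β) : Prop where
  finite_vertexSet : V(G).Finite
  finite_edgeSet : E(G).Finite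
  loopless : G.Loopless
  degree_eq : ∀ x ∈ V(G), (G.incidenceSet x).ncard = r

/-- An `r`-graph: an `r`-regular graph in which `|∂(S)| ≥ r` for every vertex set `S` of odd
cardinality. -/
structure IsRGraph (r : ℕ) (G : Graph α β) : Prop extends IsRegularMultigraph r G where
  le_edgeBoundary : ∀ S ⊆ V(G), Odd S.ncard → r ≤ (G.edgeBoundary S).ncard

/-- A permutation of the vertices is an automorphism of `G` if it preserves the number of edges
between any two vertices. -/
def IsAutomorphism (G : Graph α β) (a : Equiv.Perm V(G)) : Prop :=
  ∀ x y : V(G), {e | G.IsLink e x y}.ncard = {e | G.IsLink e (a x) (a y)}.ncard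

/-- `T` is (a copy of) the tree `T_i^r` with root `x`: all degrees are `1` or `r`, and all leaves
have distance `i` from `x`. -/
structure IsBalancedTree {V : Type u} (r i : ℕ) (T : SimpleGraph V) (x : V) : Prop where
  isTree : T.IsTree
  degree_eq : ∀ y, (T.neighborSet y).ncard = 1 ∨ (T.neighborSet y).ncard = r
  dist_leaf : ∀ y, (T.neighborSet y).ncard = 1 → T.dist x y = i

/-- `a` is an automorphism of `T` that is rotational with respect to `x`. For a periodic point
`y`, `Function.minimalPeriod a y` is the least `k > 0` with `a^k y = y`. -/
structure IsRotational {V : Type u} (T : SimpleGraph V) (x : V) (a : Equiv.Perm V) : Prop where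
  adj_iff : ∀ y z, T.Adj (a y) (a z) ↔ T.Adj y z
  period_root : Function.minimalPeriod a x = 1
  period_eq : ∀ y, y ≠ x → Function.minimalPeriod a y = (T.neighborSet x).ncard

/-- `G` is a rotation `T_i^r`-graph: it is `r`-regular and has a spanning tree `T` isomorphic to
`T_i^r` and an automorphism that is rotational on `T` with respect to the root. As trees are
simple, a spanning tree of `G` is given by its adjacency relation on the vertices of `G`. -/
def IsRotationTGraph (r i : ℕ) (G : Graph α β) : Prop :=
  G.IsRegularMultigraph r ∧
    ∃ (T : SimpleGraph V(G)) (x : V(G)) (a : Equiv.Perm V(G)),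
      (∀ y z, T.Adj y z → G.Adj y z) ∧ IsBalancedTree r i T x ∧
      G.IsAutomorphism a ∧ IsRotational T x a

/-- A rotation `r`-graph: an `r`-graph that is a rotation `T_i^r`-graph for some `i`. -/
def IsRotationRGraph (r : ℕ) (G : Graph α β) : Prop :=
  G.IsRGraph r ∧ ∃ i : ℕ, G.IsRotationTGraph r i

/-- An orientation of `G`: every edge is directed from one of its ends to the other. -/
structure Orientation (G : Graph α β) where
  tail : E(G) → V(G)
  head : E(G) → V(G)
  isLink : ∀ e : E(G), G.IsLink e (tail e) (head e)

/-- The finite graph `G` admits a nowhere-zero `k`-flow: an orientation and a map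
`f : E(G) → {±1, …, ±(k - 1)}` for which, at every vertex, the sum over the incoming edges equals
the sum over the outgoing edges. -/
def HasNowhereZeroFlow (k : ℕ) (G : Graph α β) : Prop :=
  ∃ (D : G.Orientation) (f : E(G) → ℤ),
    (∀ e, f e ≠ 0 ∧ |f e| < k) ∧
    ∀ x : V(G), ∑ᶠ e ∈ {e | D.head e = x}, f e = ∑ᶠ e ∈ {e | D.tail e = x}, f e

end Graph

set_option linter.unusedSectionVars false

/-! Only the passage from simple rotation `5`-graphs to all `5`-graphs has content. Its tool is
substitution: an edge of a `5`-graph `G` is replaced by a copy of `Q - e₀`, where `Q` is a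
`5`-graph. The result is again a `5`-graph (`IsFive.sub`). Each copy is attached by two edges only,
and these must carry equal flow. Hence a nowhere-zero `3`-flow of the result restricts to one of
`G`, and to one of `Q` if some edge was replaced (`HasFlow.base_of_sub`, `HasFlow.gadget_of_sub`).
It therefore suffices to build a given `5`-graph, which may be assumed connected, into a simple
rotation `5`-graph by substitutions.

The symmetry comes from `K₆` with five vertices rotated around the sixth, the root: one orbit of
edges is replaced by copies of `Q - e₀`. All later substitutions are made on rotation-invariant sets
of edges, so the rotation survives (`IsRotation.sub`). Consider the breadth-first layers around the
root and a rotation-invariant choice of one edge to the previous layer at each other vertex. Every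
unchosen edge between consecutive layers is replaced by `K₆` minus an edge, which makes the edge to
the previous layer unique at each vertex other than the root (`IsFive.exists_isStage`). Edges inside
layer `k` are then pushed to layer `k + 1` by a dipole minus an edge, until they all lie in the last
layer (`IsStage.succ`).

Finally, copies of `K_{5,5}` minus an edge add two layers and leave only disjoint copies of
`K_{4,4}` inside the new last layer (`IsStage.exists_isTreeLayered`). The graph is now simple, and
its edges between layers form a spanning tree in which the last layer consists of the leaves and all
other degrees are `5`. -/

/-- A multigraph with vertex type `V` and edge type `E`, with a fixed orientation of its edges and
without loops. -/
structure OGraph (V E : Type) where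
  s : E → V
  t : E → V
  ne : ∀ e, s e ≠ t e

namespace OGraph

/-! ### Oriented multigraphs: degrees, cuts, parity. -/

section basic

variable {V E : Type} [Fintype V] [Fintype E] [DecidableEq V] [DecidableEq E] (G : OGraph V E)

/-- The sum of `f` over the edges leaving `v`. -/
def outSum {M : Type} [AddCommMonoid M] (f : E → M) (v : V) : M :=
  ∑ e, if G.s e = v then f e else 0

/-- The sum of `f` over the edges entering `v`. -/
def inSum {M : Type} [AddCommMonoid M] (f : E → M) (v : V) : M :=
  ∑ e, if G.t e = v then f e else 0

/-- The edges with exactly one end in `S`. -/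
def cut (S : V → Bool) : Finset E := {e | S (G.s e) ≠ S (G.t e)}

/-- The vertices in `S`. -/
def supp (S : V → Bool) : Finset V := {v | S v = true}

/-- Every vertex of `G` has degree `5`. -/
def Regular : Prop :=
  ∀ v, G.outSum (fun _ ↦ 1) v + G.inSum (fun _ ↦ 1) v = 5

/-- `G` is a `5`-graph. -/
structure IsFive : Prop where
  regular : G.Regular
  le_cut : ∀ S : V → Bool, Odd (supp S).card → 5 ≤ (G.cut S).card

/-- `G` has a nowhere-zero `3`-flow. -/
def HasFlow : Prop :=
  ∃ f : E → ℤ, (∀ e, f e ≠ 0 ∧ |f e| < 3) ∧ ∀ v, G.outSum f v = G.inSum f v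

variable {G}

theorem mem_cut {S : V → Bool} {e : E} : e ∈ G.cut S ↔ S (G.s e) ≠ S (G.t e) := by
  simp [cut]

/-- Count the edge ends in `S` modulo `2`: each vertex contributes `5 = 1`, and edges inside `S`
contribute twice. -/
theorem Regular.parity (h : G.Regular) (S : V → Bool) :
    ((supp S).card : ZMod 2) = (G.cut S).card := by
  have h1 : ∀ v, (G.outSum (fun _ ↦ (1 : ZMod 2)) v + G.inSum (fun _ ↦ 1) v) = 1 := by
    intro v
    have := congrArg (Nat.cast : ℕ → ZMod 2) (h v)
    simp only [outSum, inSum] at this ⊢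
    push_cast at this
    rw [this]
    decide
  have h2 : ((supp S).card : ZMod 2) = ∑ v, (if S v = true then (1 : ZMod 2) else 0) *
      (G.outSum (fun _ ↦ (1 : ZMod 2)) v + G.inSum (fun _ ↦ 1) v) := by
    simp [h1, supp]
  have h3 : ((G.cut S).card : ZMod 2) = ∑ e, ((if S (G.s e) = true then (1 : ZMod 2) else 0) +
      if S (G.t e) = true then (1 : ZMod 2) else 0) := by
    rw [cut, Finset.card_filter]
    push_cast
    refine Finset.sum_congr rfl fun e _ ↦ ?_
    cases S (G.s e) <;> cases S (G.t e) <;> decide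
  rw [h2, h3]
  simp only [outSum, inSum, ← Finset.sum_add_distrib, Finset.mul_sum]
  rw [Finset.sum_comm]
  refine Finset.sum_congr rfl fun e _ ↦ ?_
  simp [mul_add, Finset.sum_add_distrib]

theorem Regular.odd_iff (h : G.Regular) (S : V → Bool) :
    Odd (supp S).card ↔ Odd (G.cut S).card := by
  rw [← ZMod.natCast_eq_one_iff_odd, ← ZMod.natCast_eq_one_iff_odd, h.parity S]

end basic

/-! ### Substitution of `Q - e₀` for edges. -/

section sub

variable {V E W F : Type}

/-- Replace every edge `e` in `N` by a copy of `Q - e₀`: the edges `e` and `e₀` exchange their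
targets. -/
def sub [DecidableEq F] (G : OGraph V E) (N : E → Bool) (Q : OGraph W F) (e₀ : F) :
    OGraph (V ⊕ {e // N e = true} × W) (E ⊕ {e // N e = true} × F) where
  s := Sum.map G.s (Prod.map id Q.s)
  t := Sum.elim (fun e ↦ if h : N e = true then .inr (⟨e, h⟩, Q.t e₀) else .inl (G.t e))
    (fun p ↦ if p.2 = e₀ then .inl (G.t p.1) else .inr (p.1, Q.t p.2))
  ne := by
    rintro (e | ⟨e, f⟩)
    · by_cases h : N e = true
      · simp [h]
      · simpa [h] using G.ne e
    · by_cases h : f = e₀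
      · simp [h]
      · simpa [h] using Q.ne f

section ends

variable [DecidableEq F] {G : OGraph V E} {N : E → Bool} {Q : OGraph W F} {e₀ : F}

@[simp]
theorem sub_s_inl (e : E) : (G.sub N Q e₀).s (.inl e) = .inl (G.s e) := rfl

@[simp]
theorem sub_s_inr (e : {e // N e = true}) (f : F) :
    (G.sub N Q e₀).s (.inr (e, f)) = .inr (e, Q.s f) := rfl

theorem sub_t_inl_of_mem (e : {e // N e = true}) :
    (G.sub N Q e₀).t (.inl e.1) = .inr (e, Q.t e₀) := by
  simp [sub, e.2]

theorem sub_t_inl_of_mem' {e : E} (h : N e = true) :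
    (G.sub N Q e₀).t (.inl e) = .inr (⟨e, h⟩, Q.t e₀) :=
  sub_t_inl_of_mem ⟨e, h⟩

theorem sub_t_inl_of_notMem {e : E} (h : N e ≠ true) :
    (G.sub N Q e₀).t (.inl e) = .inl (G.t e) := by
  simp [sub, h]

@[simp]
theorem sub_t_inr_self (e : {e // N e = true}) :
    (G.sub N Q e₀).t (.inr (e, e₀)) = .inl (G.t e) := by
  simp [sub]

theorem sub_t_inr_of_ne (e : {e // N e = true}) {f : F} (h : f ≠ e₀) :
    (G.sub N Q e₀).t (.inr (e, f)) = .inr (e, Q.t f) := by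
  simp [sub, h]

end ends

variable [Fintype V] [Fintype E] [DecidableEq V] [DecidableEq E]
  [Fintype W] [Fintype F] [DecidableEq W] [DecidableEq F]
  {G : OGraph V E} {N : E → Bool} {Q : OGraph W F} {e₀ : F}

section sums

variable {M : Type} [AddCommMonoid M] (f : E ⊕ {e // N e = true} × F → M)

theorem sub_outSum_inl (v : V) :
    (G.sub N Q e₀).outSum f (.inl v) = G.outSum (fun e ↦ f (.inl e)) v := by
  simp [outSum, Fintype.sum_prod_type]

theorem sub_outSum_inr (e : {e // N e = true}) (w : W) :
    (G.sub N Q e₀).outSum f (.inr (e, w)) = Q.outSum (fun g ↦ f (.inr (e, g))) w := by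
  simp only [outSum, Fintype.sum_sum_type, sub_s_inl, reduceCtorEq, if_false,
    Finset.sum_const_zero, zero_add]
  rw [Fintype.sum_prod_type, Finset.sum_eq_single e]
  · simp
  · intro b _ hb
    simp [hb]
  · simp

/-- A replaced edge no longer enters `v`; the copy of `e₀` in its gadget does so in its place. -/
theorem sub_inSum_inl (v : V) :
    (G.sub N Q e₀).inSum f (.inl v) = G.inSum
      (fun e ↦ if h : N e = true then f (.inr (⟨e, h⟩, e₀)) else f (.inl e)) v := by
  have h1 : ∀ e : {e // N e = true}, (∑ g, if (G.sub N Q e₀).t (.inr (e, g)) = .inl v then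
      f (.inr (e, g)) else 0) = if G.t e = v then f (.inr (e, e₀)) else 0 := by
    intro e
    rw [Finset.sum_eq_single e₀]
    · simp
    · intro b _ hb
      simp [sub_t_inr_of_ne e hb]
    · simp
  have h2 : (∑ e : {e // N e = true}, if G.t e = v then f (.inr (e, e₀)) else 0) =
      ∑ e, if h : N e = true then if G.t e = v then f (.inr (⟨e, h⟩, e₀)) else 0 else 0 := by
    rw [Finset.sum_dite, Finset.sum_const_zero, add_zero]
    refine Finset.sum_bij (fun e _ ↦ ⟨e.1, by simp [e.2]⟩) ?_ ?_ ?_ ?_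
    · simp
    · intro a _ b _ hab
      simpa [Subtype.ext_iff] using hab
    · rintro ⟨b, hb⟩ _
      exact ⟨⟨b, by simpa using hb⟩, Finset.mem_univ _, rfl⟩
    · simp
  rw [inSum, Fintype.sum_sum_type, Fintype.sum_prod_type, Finset.sum_congr rfl fun e _ ↦ h1 e, h2,
    ← Finset.sum_add_distrib, inSum]
  refine Finset.sum_congr rfl fun e _ ↦ ?_
  by_cases h : N e = true
  · simp [sub_t_inl_of_mem' h, h]
  · simp [sub_t_inl_of_notMem h, h]

theorem sub_inSum_inr (e : {e // N e = true}) (w : W) :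
    (G.sub N Q e₀).inSum f (.inr (e, w)) =
      Q.inSum (fun g ↦ if g = e₀ then f (.inl e) else f (.inr (e, g))) w := by
  rw [inSum, Fintype.sum_sum_type, Fintype.sum_prod_type, Finset.sum_eq_single e.1,
    Finset.sum_eq_single e, ← Finset.add_sum_erase _ _ (Finset.mem_univ e₀), inSum,
    ← Finset.add_sum_erase _ _ (Finset.mem_univ e₀)]
  · rw [sub_t_inl_of_mem, sub_t_inr_self]
    simp only [reduceCtorEq, if_false, zero_add, if_true, Sum.inr.injEq, Prod.mk.injEq, true_and]
    congr 1
    refine Finset.sum_congr rfl fun g hg ↦ ?_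
    have hg' := Finset.ne_of_mem_erase hg
    simp [sub_t_inr_of_ne e hg', hg']
  · intro b _ hb
    refine Finset.sum_eq_zero fun g _ ↦ ?_
    by_cases hg : g = e₀
    · simp [hg]
    · simp [sub_t_inr_of_ne b hg, hb]
  · simp
  · intro b _ hb
    by_cases h : N b = true
    · rw [sub_t_inl_of_mem' h, if_neg]
      simp only [Sum.inr.injEq, Prod.mk.injEq, not_and]
      rintro rfl
      exact absurd rfl hb
    · simp [sub_t_inl_of_notMem h]
  · simp

end sums

theorem Regular.sub (hG : G.Regular) (hQ : Q.Regular) : (G.sub N Q e₀).Regular := by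
  rintro (v | ⟨e, w⟩)
  · rw [sub_outSum_inl, sub_inSum_inl]
    simpa using hG v
  · rw [sub_outSum_inr, sub_inSum_inr]
    simpa using hQ w

theorem card_supp_sum (S : V ⊕ {e // N e = true} × W → Bool) :
    (supp S).card = (supp fun v ↦ S (.inl v)).card +
      ∑ e : {e // N e = true}, (supp fun w ↦ S (.inr (e, w))).card := by
  simp only [supp, Finset.card_filter, Fintype.sum_sum_type, Fintype.sum_prod_type]

/-- If `S` meets some copy in an odd set, the cut of `Q` has at least five edges, at least four of
them other than `e₀`; these survive, and the cut of an odd set is odd, so there is a fifth.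
Otherwise `S` meets `V` in an odd set, and each edge `e` of the cut in `G` yields a cut edge at `e`
or in its copy: if not, `e₀` alone would be the cut of an even set in `Q`, against parity. -/
theorem IsFive.sub (hG : G.IsFive) (hQ : Q.IsFive) : (G.sub N Q e₀).IsFive := by
  have hR : (G.sub N Q e₀).Regular := hG.regular.sub hQ.regular
  refine ⟨hR, fun S hS ↦ ?_⟩
  by_cases h : ∃ e : {e // N e = true}, Odd (supp fun w ↦ S (.inr (e, w))).card
  · obtain ⟨e, he⟩ := h
    have h1 := hQ.le_cut _ he
    have h2 : (((Q.cut fun w ↦ S (.inr (e, w))).erase e₀).image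
        fun f ↦ (.inr (e, f) : E ⊕ {e // N e = true} × F)) ⊆ (G.sub N Q e₀).cut S := by
      intro g hg
      obtain ⟨f, hf, rfl⟩ := Finset.mem_image.1 hg
      obtain ⟨hf1, hf2⟩ := Finset.mem_erase.1 hf
      rw [mem_cut] at hf2 ⊢
      rwa [sub_s_inr, sub_t_inr_of_ne e hf1]
    have h3 := Finset.card_le_card h2
    rw [Finset.card_image_of_injective _ (fun a b hab ↦ by simpa using hab)] at h3
    have h4 := Finset.pred_card_le_card_erase (s := Q.cut fun w ↦ S (.inr (e, w))) (a := e₀)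
    have h5 := (hR.odd_iff S).1 hS
    obtain ⟨k, hk⟩ := h5
    omega
  · push Not at h
    have hodd : Odd (supp fun v ↦ S (.inl v)).card := by
      rw [card_supp_sum, Nat.odd_add] at hS
      exact hS.2 (Finset.even_sum _ fun e _ ↦ Nat.not_odd_iff_even.1 (h e))
    refine (hG.le_cut _ hodd).trans ?_
    refine (Finset.card_le_card (t := ((G.sub N Q e₀).cut S).image
      (Sum.elim id fun p ↦ p.1.1)) ?_).trans Finset.card_image_le
    intro e he
    rw [mem_cut] at he
    rw [Finset.mem_image]
    by_cases hN : N e = true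
    · by_contra! hcon
      have c1 : .inl e ∉ (G.sub N Q e₀).cut S := fun hc ↦ hcon _ hc rfl
      have c2 : ∀ f, .inr (⟨e, hN⟩, f) ∉ (G.sub N Q e₀).cut S :=
        fun f hc ↦ hcon _ hc rfl
      have c3 := c2 e₀
      rw [mem_cut, not_not] at c1 c3
      rw [sub_s_inr, sub_t_inr_self] at c3
      rw [sub_s_inl, sub_t_inl_of_mem' hN] at c1
      have h1 : (Q.cut fun w ↦ S (.inr (⟨e, hN⟩, w))) = {e₀} := by
        ext f
        rw [mem_cut, Finset.mem_singleton]
        constructor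
        · intro hf
          by_contra hfe
          refine c2 f ?_
          rwa [mem_cut, sub_s_inr, sub_t_inr_of_ne _ hfe]
        · rintro rfl
          rw [c3, ← c1]
          exact he.symm
      have h2 := h ⟨e, hN⟩
      rw [hQ.regular.odd_iff, h1] at h2
      simp at h2
    · refine ⟨.inl e, ?_, rfl⟩
      rw [mem_cut, sub_s_inl, sub_t_inl_of_notMem hN]
      exact he

/-- Summing conservation over the vertices of the copy cancels all inner edges and leaves the one
edge that enters the copy and the one that leaves it. -/
theorem sub_flow_link {f : E ⊕ {e // N e = true} × F → ℤ}
    (hf : ∀ v, (G.sub N Q e₀).outSum f v = (G.sub N Q e₀).inSum f v) (e : {e // N e = true}) :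
    f (.inl e) = f (.inr (e, e₀)) := by
  have h1 : ∀ w, Q.outSum (fun g ↦ f (.inr (e, g))) w =
      Q.inSum (fun g ↦ if g = e₀ then f (.inl e) else f (.inr (e, g))) w := by
    intro w
    rw [← sub_outSum_inr (G := G) (e₀ := e₀), hf, sub_inSum_inr]
  have h2 : ∑ w, Q.outSum (fun g ↦ f (.inr (e, g))) w =
      ∑ w, Q.inSum (fun g ↦ if g = e₀ then f (.inl e) else f (.inr (e, g))) w :=
    Finset.sum_congr rfl fun w _ ↦ h1 w
  simp only [outSum, inSum] at h2
  rw [Finset.sum_comm, Finset.sum_comm (γ := W)] at h2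
  simp only [Finset.sum_ite_eq, Finset.mem_univ, if_true] at h2
  rw [← Finset.add_sum_erase _ _ (Finset.mem_univ e₀), ← Finset.add_sum_erase _ _
      (Finset.mem_univ e₀)] at h2
  have h3 : ∑ g ∈ Finset.univ.erase e₀, (if g = e₀ then f (.inl e) else f (.inr (e, g))) =
      ∑ g ∈ Finset.univ.erase e₀, f (.inr (e, g)) :=
    Finset.sum_congr rfl fun g hg ↦ by simp [Finset.ne_of_mem_erase hg]
  rw [h3] at h2
  simpa using (add_right_cancel h2).symm

theorem HasFlow.base_of_sub (h : (G.sub N Q e₀).HasFlow) : G.HasFlow := by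
  obtain ⟨f, h0, hf⟩ := h
  refine ⟨fun e ↦ f (.inl e), fun e ↦ h0 _, fun v ↦ ?_⟩
  rw [← sub_outSum_inl (Q := Q) (e₀ := e₀), hf, sub_inSum_inl]
  congr 1
  ext e
  split_ifs with hN
  · exact (sub_flow_link hf ⟨e, hN⟩).symm
  · rfl

theorem HasFlow.gadget_of_sub (h : (G.sub N Q e₀).HasFlow) (e : {e // N e = true}) :
    Q.HasFlow := by
  obtain ⟨f, h0, hf⟩ := h
  refine ⟨fun g ↦ f (.inr (e, g)), fun e ↦ h0 _, fun v ↦ ?_⟩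
  rw [← sub_outSum_inr (G := G) (e₀ := e₀), hf, sub_inSum_inr]
  congr 1
  ext g
  split_ifs with hN
  · rw [sub_flow_link hf, hN]
  · rfl

end sub

end OGraph

/-! ### The gadgets `K₆`, dipole and `K_{5,5}`. -/

namespace OGraph

/-- The complete graph on six vertices, five of which are rotated around the sixth. -/
def completeSix : OGraph (Option (Fin 5)) (Fin 5 × Fin 3) where
  s e := some e.1
  t e := if e.2 = 0 then none else some (e.1 + e.2.castLE (by decide))
  ne := by decide

theorem completeSix_isFive : completeSix.IsFive where
  regular := by
    unfold Regular outSum inSum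
    decide
  le_cut := by
    set_option maxRecDepth 100000 in
    decide +kernel

/-- Two vertices joined by five parallel edges. -/
def dipole : OGraph Bool (Fin 5) where
  s _ := false
  t _ := true
  ne := by decide

theorem dipole_isFive : dipole.IsFive where
  regular := by
    unfold Regular outSum inSum
    decide
  le_cut := by decide

/-- The complete bipartite graph with five vertices on each side. -/
def completeBipartite : OGraph (Bool × Fin 5) (Fin 5 × Fin 5) where
  s e := (false, e.1)
  t e := (true, e.2)
  ne := by simp

/-- If `S` has `A` and `B` vertices on the two sides, the triangle inequality bounds its cut below
by `5 * |B - A|`, and `A + B` odd forces `A ≠ B`. -/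
theorem completeBipartite_isFive : completeBipartite.IsFive where
  regular := by
    unfold Regular outSum inSum
    decide
  le_cut S hS := by
    have h1 : (supp S).card = (∑ i, if S (true, i) = true then 1 else 0) +
        ∑ i, if S (false, i) = true then 1 else 0 := by
      simp only [supp, Finset.card_filter, Fintype.sum_prod_type, Fintype.sum_bool]
    have h2 : (completeBipartite.cut S).card =
        ∑ i, ∑ j, if S (false, i) ≠ S (true, j) then 1 else 0 := by
      simp only [cut, Finset.card_filter, Fintype.sum_prod_type]
      rfl
    set a : Fin 5 → ℤ := fun i ↦ if S (true, i) = true then 1 else 0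
    set b : Fin 5 → ℤ := fun i ↦ if S (false, i) = true then 1 else 0
    have h3 : ((supp S).card : ℤ) = (∑ i, a i) + ∑ i, b i := by
      rw [h1]
      push_cast
      rfl
    have h4 : ((completeBipartite.cut S).card : ℤ) = ∑ i, ∑ j, |b i - a j| := by
      rw [h2]
      push_cast
      refine Finset.sum_congr rfl fun i _ ↦ Finset.sum_congr rfl fun j _ ↦ ?_
      cases h : S (false, i) <;> cases h' : S (true, j) <;> simp [a, b, h, h']
    have h5 : |∑ i, ∑ j, (b i - a j)| ≤ ∑ i, ∑ j, |b i - a j| :=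
      (Finset.abs_sum_le_sum_abs _ _).trans
        (Finset.sum_le_sum fun i _ ↦ Finset.abs_sum_le_sum_abs _ _)
    have h6 : ∑ i, ∑ j, (b i - a j) = 5 * ((∑ i, b i) - ∑ i, a i) := by
      simp [Finset.mul_sum, mul_sub]
    rw [h6, ← h4] at h5
    obtain ⟨k, hk⟩ := hS
    have := abs_le.1 h5
    omega

/-! ### Rotations and layerings under substitution. -/

section layered

variable {V E W F : Type}

/-- The edge `e` joins `v` to a vertex of depth one less than that of `v`. -/
def Down (G : OGraph V E) (d : V → ℕ) (v : V) (e : E) : Prop :=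
  (G.s e = v ∧ d (G.t e) + 1 = d v) ∨ (G.t e = v ∧ d (G.s e) + 1 = d v)

instance [DecidableEq V] (G : OGraph V E) (d : V → ℕ) (v : V) (e : E) : Decidable (G.Down d v e) :=
  inferInstanceAs (Decidable (_ ∨ _))

/-- The pair `σ, τ` is an automorphism of order `5` that fixes only `x` and preserves `d`. -/
structure IsRotation (G : OGraph V E) (x : V) (σ : V → V) (τ : E → E) (d : V → ℕ) : Prop where
  s_map : ∀ e, G.s (τ e) = σ (G.s e)
  t_map : ∀ e, G.t (τ e) = σ (G.t e)
  iter_vertex : ∀ v, σ (σ (σ (σ (σ v)))) = v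
  iter_edge : ∀ e, τ (τ (τ (τ (τ e)))) = e
  map_root : σ x = x
  eq_root : ∀ v, σ v = v → v = x
  depth_map : ∀ v, d (σ v) = d v

/-- Depths of the ends of an edge differ by at most one, and every vertex other than the root `x`
has exactly one edge to the previous layer. -/
structure IsLayered (G : OGraph V E) (x : V) (d : V → ℕ) : Prop where
  depth_eq_zero : ∀ v, d v = 0 ↔ v = x
  depth_le : ∀ e, d (G.s e) ≤ d (G.t e) + 1 ∧ d (G.t e) ≤ d (G.s e) + 1
  existsUnique_down : ∀ v, v ≠ x → ∃! e, G.Down d v e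

/-- The function `κ` assigns depths to the vertices of `Q - e₀`, for which each vertex that is not
an end of `e₀` has exactly one edge to the previous layer, and the ends of `e₀` have none. -/
structure IsProfile (Q : OGraph W F) (e₀ : F) (κ : W → ℕ) : Prop where
  pos : ∀ w, 0 < κ w
  depth_le : ∀ f, f ≠ e₀ → κ (Q.s f) ≤ κ (Q.t f) + 1 ∧ κ (Q.t f) ≤ κ (Q.s f) + 1
  exists_down : ∀ w, w ≠ Q.s e₀ → w ≠ Q.t e₀ → ∃ f, Q.Down κ w f
  down_unique : ∀ w f f', f ≠ e₀ → f' ≠ e₀ → Q.Down κ w f → Q.Down κ w f' → f = f'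
  not_down : ∀ f, f ≠ e₀ → ¬ Q.Down κ (Q.s e₀) f ∧ ¬ Q.Down κ (Q.t e₀) f

variable [DecidableEq F] {G : OGraph V E} {N : E → Bool} {Q : OGraph W F} {e₀ : F}

/-- Both ends of a fixed edge would be fixed, hence equal to the root. Consequently no copy inserted
by a substitution is mapped to itself. -/
theorem IsRotation.edge_ne {x : V} {σ : V → V} {τ : E → E} {d : V → ℕ}
    (h : G.IsRotation x σ τ d) (e : E) : τ e ≠ e := by
  intro he
  have h1 := h.s_map e
  have h2 := h.t_map e
  rw [he] at h1 h2
  exact G.ne e ((h.eq_root _ h1.symm).trans (h.eq_root _ h2.symm).symm)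

theorem IsRotation.sub {x : V} {σ : V → V} {τ : E → E} {d : V → ℕ} (h : G.IsRotation x σ τ d)
    (hN : ∀ e, N (τ e) = N e) (δ : E → W → ℕ) (hδ : ∀ e w, δ (τ e) w = δ e w) :
    (G.sub N Q e₀).IsRotation (.inl x)
      (Sum.map σ (Prod.map (Subtype.map τ fun e he ↦ (hN e).trans he) id))
      (Sum.map τ (Prod.map (Subtype.map τ fun e he ↦ (hN e).trans he) id))
      (Sum.elim d fun p ↦ δ p.1 p.2) where
  s_map := by
    rintro (e | ⟨e, f⟩)
    · simp [h.s_map]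
    · simp
  t_map := by
    rintro (e | ⟨e, f⟩)
    · by_cases he : N e = true
      · rw [sub_t_inl_of_mem' he, Sum.map_inl, sub_t_inl_of_mem' ((hN e).trans he)]
        rfl
      · rw [sub_t_inl_of_notMem he, Sum.map_inl, sub_t_inl_of_notMem (by rwa [hN]), h.t_map]
        rfl
    · by_cases hf : f = e₀
      · subst hf
        simp [h.t_map, Subtype.map]
      · simp [sub_t_inr_of_ne _ hf]
  iter_vertex := by
    rintro (v | ⟨e, f⟩)
    · simp [h.iter_vertex]
    · simp [Subtype.map, h.iter_edge]
  iter_edge := by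
    rintro (v | ⟨e, f⟩)
    · simp [h.iter_edge]
    · simp [Subtype.map, h.iter_edge]
  map_root := by simp [h.map_root]
  eq_root := by
    rintro (v | ⟨e, f⟩) hv
    · simpa using h.eq_root v (by simpa using hv)
    · simp [Subtype.map, Subtype.ext_iff, h.edge_ne] at hv
  depth_map := by
    rintro (v | ⟨e, f⟩)
    · simp [h.depth_map]
    · simp [Subtype.map, hδ]

/-- The conditions `hs` and `ht` place each attaching vertex of a copy one layer beyond the end of
`e` to which it is joined. So replaced edges no longer lead down from vertices of `G`, and each end
of `e₀` receives its unique downward edge from outside; all other vertices of the copy have theirs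
inside, by the profile. -/
theorem IsLayered.sub {x : V} {d : V → ℕ} {l : E → ℕ} {κ : E → W → ℕ}
    (h0 : ∀ v, d v = 0 ↔ v = x)
    (hd : ∀ e, N e ≠ true → d (G.s e) ≤ d (G.t e) + 1 ∧ d (G.t e) ≤ d (G.s e) + 1)
    (hu : ∀ v, v ≠ x → ∃! e, N e ≠ true ∧ G.Down d v e)
    (hκ : ∀ e, N e = true → Q.IsProfile e₀ (κ e))
    (hs : ∀ e, N e = true → l e + κ e (Q.t e₀) = d (G.s e) + 1)
    (ht : ∀ e, N e = true → l e + κ e (Q.s e₀) = d (G.t e) + 1) :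
    (G.sub N Q e₀).IsLayered (.inl x) (Sum.elim d fun p ↦ l p.1 + κ p.1 p.2) where
  depth_eq_zero := by
    rintro (v | ⟨e, w⟩)
    · simp [h0]
    · have := (hκ e e.2).pos w
      simp only [Sum.elim_inr, reduceCtorEq, iff_false]
      omega
  depth_le := by
    rintro (e | ⟨e, f⟩)
    · by_cases he : N e = true
      · rw [sub_t_inl_of_mem' he]
        simp [hs e he]
        omega
      · simpa [sub_t_inl_of_notMem he] using hd e he
    · by_cases hf : f = e₀
      · subst hf
        simp [ht e e.2]
        omega
      · have := (hκ e e.2).depth_le f hf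
        simp only [sub_s_inr, sub_t_inr_of_ne e hf, Sum.elim_inr]
        omega
  existsUnique_down := by
    rintro (v | ⟨e, w⟩) hv
    · obtain ⟨e, ⟨he, hde⟩, huniq⟩ := hu v (by simpa using hv)
      refine ⟨.inl e, ?_, ?_⟩
      · simpa [Down, sub_t_inl_of_notMem he] using hde
      · rintro (e' | ⟨e', f⟩) he'
        · by_cases hN : N e' = true
          · exfalso
            have := hs e' hN
            simp only [Down, sub_s_inl, sub_t_inl_of_mem' hN, Sum.inl.injEq, Sum.elim_inr,
              Sum.elim_inl, reduceCtorEq, false_and, or_false] at he'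
            obtain ⟨rfl, h2⟩ := he'
            omega
          · rw [huniq e' ⟨hN, by simpa [Down, sub_t_inl_of_notMem hN] using he'⟩]
        · exfalso
          by_cases hf : f = e₀
          · subst hf
            have := ht e' e'.2
            simp only [Down, sub_s_inr, sub_t_inr_self, Sum.inl.injEq, Sum.elim_inr,
              Sum.elim_inl, reduceCtorEq, false_and, false_or] at he'
            obtain ⟨rfl, h2⟩ := he'
            omega
          · simp [Down, sub_t_inr_of_ne e' hf] at he'
    · have hp := hκ e e.2
      have h1 := hs e e.2
      have h2 := ht e e.2
      have hin : ∀ f, f ≠ e₀ → ((G.sub N Q e₀).Down (Sum.elim d fun p ↦ l p.1 + κ p.1 p.2)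
          (.inr (e, w)) (.inr (e, f)) ↔ Q.Down (κ e) w f) := by
        intro f hf
        simp only [Down, sub_s_inr, sub_t_inr_of_ne e hf, Sum.inr.injEq, Prod.mk.injEq, true_and,
          Sum.elim_inr]
        refine or_congr (and_congr_right fun _ ↦ ?_) (and_congr_right fun _ ↦ ?_) <;> omega
      have hout : ∀ g, (G.sub N Q e₀).Down (Sum.elim d fun p ↦ l p.1 + κ p.1 p.2)
          (.inr (e, w)) g → (g = .inl e.1 ∧ w = Q.t e₀) ∨ (g = .inr (e, e₀) ∧ w = Q.s e₀) ∨
            ∃ f, f ≠ e₀ ∧ g = .inr (e, f) := by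
        rintro (e' | ⟨e', f⟩) hg
        · left
          by_cases hN : N e' = true
          · simp only [Down, sub_s_inl, sub_t_inl_of_mem' hN, reduceCtorEq, false_and, false_or,
              Sum.inr.injEq, Prod.mk.injEq] at hg
            obtain ⟨⟨rfl, rfl⟩, -⟩ := hg
            exact ⟨rfl, rfl⟩
          · simp [Down, sub_t_inl_of_notMem hN] at hg
        · right
          by_cases hf : f = e₀
          · subst hf
            simp only [Down, sub_s_inr, sub_t_inr_self, reduceCtorEq, false_and, or_false,
              Sum.inr.injEq, Prod.mk.injEq] at hg
            obtain ⟨⟨rfl, rfl⟩, -⟩ := hg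
            exact .inl ⟨rfl, rfl⟩
          · right
            simp only [Down, sub_s_inr, sub_t_inr_of_ne e' hf, Sum.inr.injEq, Prod.mk.injEq] at hg
            obtain ⟨⟨rfl, -⟩, -⟩ | ⟨⟨rfl, -⟩, -⟩ := hg <;> exact ⟨f, hf, rfl⟩
      have hst := Q.ne e₀
      by_cases hws : w = Q.s e₀
      · subst hws
        refine ⟨.inr (e, e₀), ?_, fun g hg ↦ ?_⟩
        · simp [Down, h2]
        · obtain ⟨-, h3⟩ | ⟨rfl, -⟩ | ⟨f, hf, rfl⟩ := hout g hg
          · exact absurd h3 hst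
          · rfl
          · exact absurd ((hin f hf).1 hg) (hp.not_down f hf).1
      by_cases hwt : w = Q.t e₀
      · subst hwt
        refine ⟨.inl e, ?_, fun g hg ↦ ?_⟩
        · simp [Down, sub_t_inl_of_mem, h1]
        · obtain ⟨rfl, -⟩ | ⟨-, h3⟩ | ⟨f, hf, rfl⟩ := hout g hg
          · rfl
          · exact absurd h3.symm hst
          · exact absurd ((hin f hf).1 hg) (hp.not_down f hf).2
      · obtain ⟨f, hf⟩ := hp.exists_down w hws hwt
        have hfe : f ≠ e₀ := by
          rintro rfl
          obtain ⟨h3, -⟩ | ⟨h3, -⟩ := hf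
          · exact hws h3.symm
          · exact hwt h3.symm
        refine ⟨.inr (e, f), (hin f hfe).2 hf, fun g hg ↦ ?_⟩
        obtain ⟨-, h3⟩ | ⟨-, h3⟩ | ⟨f', hf', rfl⟩ := hout g hg
        · exact absurd h3 hwt
        · exact absurd h3 hws
        · rw [hp.down_unique w f f' hfe hf' hf ((hin f' hf').1 hg)]

theorem IsLayered.sub_of_level {x : V} {d : V → ℕ} {κ : W → ℕ} (h : G.IsLayered x d)
    (hN : ∀ e, N e = true → d (G.s e) = d (G.t e)) (hκ : Q.IsProfile e₀ κ)
    (hs : κ (Q.t e₀) = 1) (ht : κ (Q.s e₀) = 1) :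
    (G.sub N Q e₀).IsLayered (.inl x) (Sum.elim d fun p ↦ d (G.s p.1) + κ p.2) := by
  refine IsLayered.sub (l := fun e ↦ d (G.s e)) (κ := fun _ ↦ κ) h.depth_eq_zero
    (fun e _ ↦ h.depth_le e) (fun v hv ↦ ?_) (fun _ _ ↦ hκ) (fun e _ ↦ by rw [hs])
    (fun e he ↦ by rw [ht, hN e he])
  obtain ⟨e, he, huniq⟩ := h.existsUnique_down v hv
  refine ⟨e, ⟨fun hNe ↦ ?_, he⟩, fun e' he' ↦ huniq e' he'.2⟩
  have := hN e hNe
  obtain ⟨rfl, h1⟩ | ⟨rfl, h1⟩ := he <;> omega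

end layered

/-- The end `some i` of `e₀` lies in front and all other vertices one layer behind it. Each of these
has one edge to `some i`, except the other end of `e₀`, whose edge is removed. -/
theorem isProfile_completeSix (i : Fin 5) (hi : i = 0 ∨ i = 1) :
    completeSix.IsProfile (0, 1) fun w ↦ if w = some i then 1 else 2 where
  pos w := by split_ifs <;> simp
  depth_le := by obtain rfl | rfl := hi <;> decide
  exists_down := by obtain rfl | rfl := hi <;> decide
  down_unique := by obtain rfl | rfl := hi <;> decide +kernel
  not_down := by obtain rfl | rfl := hi <;> decide

theorem isProfile_dipole : dipole.IsProfile 0 fun _ ↦ 1 where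
  pos w := by simp
  depth_le := by decide
  exists_down := by decide
  down_unique := by decide
  not_down := by decide

theorem isProfile_completeBipartite :
    completeBipartite.IsProfile (0, 0) fun w ↦ if w.2 = 0 then 1 else 2 where
  pos w := by split_ifs <;> simp
  depth_le := by decide
  exists_down := by decide
  down_unique := by
    simp only [Down, completeBipartite]
    rintro ⟨b, i⟩ ⟨f1, f2⟩ ⟨g1, g2⟩ h1 h2 h3 h4
    simp at *
    grind
  not_down := by decide

end OGraph

/-! ### Pushing edges inside layers to the last layer. -/

namespace OGraph

/-- There is a layered `5`-graph with a rotation, without edges inside the layers before layer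
`k`, for which a nowhere-zero `3`-flow implies `P`. -/
def IsStage (M k : ℕ) (P : Prop) : Prop :=
  ∃ (V E : Type) (_ : Fintype V) (_ : Fintype E) (_ : DecidableEq V) (_ : DecidableEq E)
    (G : OGraph V E) (x : V) (σ : V → V) (τ : E → E) (d : V → ℕ),
    G.IsFive ∧ G.IsRotation x σ τ d ∧ G.IsLayered x d ∧ (∀ v, d v ≤ max M k) ∧
      (∀ e, d (G.s e) = d (G.t e) → k ≤ d (G.s e)) ∧ (G.HasFlow → P)

/-- An edge `uv` inside layer `k` becomes a path from `u` to `v` through two new vertices of layer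
`k + 1`, whose middle edge has multiplicity four. Only layer `k + 1` gains inner edges. -/
theorem IsStage.succ {M k : ℕ} {P : Prop} (h : IsStage M k P) : IsStage M (k + 1) P := by
  obtain ⟨V, E, _, _, _, _, G, x, σ, τ, d, h5, hr, hl, hM, hk, hP⟩ := h
  let N : E → Bool := fun e ↦ decide (d (G.s e) = k ∧ d (G.t e) = k)
  have hN : ∀ e, N e = true ↔ d (G.s e) = k ∧ d (G.t e) = k := fun e ↦ decide_eq_true_iff
  refine ⟨_, _, inferInstance, inferInstance, inferInstance, inferInstance, G.sub N dipole 0, .inl x,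
    _, _, _, h5.sub dipole_isFive,
    hr.sub (fun e ↦ by simp [N, hr.s_map, hr.t_map, hr.depth_map]) (fun e _ ↦ d (G.s e) + 1)
      (fun e _ ↦ by simp [hr.s_map, hr.depth_map]),
    hl.sub_of_level (fun e he ↦ ?_) isProfile_dipole rfl rfl, ?_, ?_, fun hf ↦ hP hf.base_of_sub⟩
  · rw [((hN e).1 he).1, ((hN e).1 he).2]
  · rintro (v | ⟨e, w⟩)
    · have := hM v
      simp only [Sum.elim_inl]
      omega
    · have := (hN e).1 e.2
      simp only [Sum.elim_inr]
      omega
  · rintro (e | ⟨e, f⟩) he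
    · by_cases hNe : N e = true
      · rw [sub_t_inl_of_mem' hNe] at he
        simp at he
      · rw [sub_t_inl_of_notMem hNe] at he
        simp only [sub_s_inl, Sum.elim_inl] at he ⊢
        have h1 := hk e he
        rw [hN] at hNe
        omega
    · have := (hN e).1 e.2
      simp only [sub_s_inr, Sum.elim_inr]
      omega

theorem IsStage.of_zero {M : ℕ} {P : Prop} (h : IsStage M 0 P) (k : ℕ) : IsStage M k P := by
  induction k with
  | zero => exact h
  | succ k ih => exact ih.succ

section

variable {V E : Type} (G : OGraph V E)

/-- The edges `e` and `e'` have the same ends. -/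
def Parallel (e e' : E) : Prop :=
  (G.s e = G.s e' ∧ G.t e = G.t e') ∨ (G.s e = G.t e' ∧ G.t e = G.s e')

/-- A graph with layers of which only the last one, with number `D`, spans edges. -/
structure IsTreeLayered (x : V) (d : V → ℕ) (D : ℕ) : Prop extends G.IsLayered x d where
  depth_le_last : ∀ v, d v ≤ D
  depth_of_level : ∀ e, d (G.s e) = d (G.t e) → d (G.s e) = D
  pos : 0 < D
  eq_of_parallel : ∀ e e', G.Parallel e e' → e = e'

variable {G}

/-- Parallel edges between different layers both lead down from their common deeper end, where such
an edge is unique. -/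
theorem IsLayered.eq_of_parallel {x : V} {d : V → ℕ} (h : G.IsLayered x d) {e e' : E}
    (hp : G.Parallel e e') (hd : d (G.s e) ≠ d (G.t e)) : e = e' := by
  have key : ∀ v, G.Down d v e → G.Down d v e' → e = e' := by
    intro v h1 h2
    refine (h.existsUnique_down v ?_).unique h1 h2
    rw [Ne, ← h.depth_eq_zero]
    obtain ⟨-, h3⟩ | ⟨-, h3⟩ := h1 <;> omega
  have hle := h.depth_le e
  obtain hlt | hlt := lt_or_gt_of_ne hd
  · refine key (G.t e) (.inr ⟨rfl, by omega⟩) ?_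
    obtain ⟨h1, h2⟩ | ⟨h1, h2⟩ := hp
    · exact .inr ⟨h2.symm, by rw [← h1]; omega⟩
    · exact .inl ⟨h2.symm, by rw [← h1]; omega⟩
  · refine key (G.s e) (.inl ⟨rfl, by omega⟩) ?_
    obtain ⟨h1, h2⟩ | ⟨h1, h2⟩ := hp
    · exact .inl ⟨h1.symm, by rw [← h2]; omega⟩
    · exact .inr ⟨h1.symm, by rw [← h2]; omega⟩

end

/-- At stage `M` no depth exceeds `M`, so all edges inside layers lie in layer `M`. In `K_{5,5} -
e₀` the ends of `e₀` go to layer `M + 1` and the other eight vertices to layer `M + 2`. -/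
theorem IsStage.exists_isTreeLayered {M : ℕ} {P : Prop} (h : IsStage M M P) :
    ∃ (V E : Type) (_ : Fintype V) (_ : Fintype E) (_ : DecidableEq V) (_ : DecidableEq E)
      (G : OGraph V E) (x : V) (σ : V → V) (τ : E → E) (d : V → ℕ) (D : ℕ),
      G.IsFive ∧ G.IsRotation x σ τ d ∧ G.IsTreeLayered x d D ∧ (G.HasFlow → P) := by
  obtain ⟨V, E, _, _, _, _, G, x, σ, τ, d, h5, hr, hl, hM, hk, hP⟩ := h
  let N : E → Bool := fun e ↦ decide (d (G.s e) = d (G.t e))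
  have hN : ∀ e, N e = true ↔ d (G.s e) = d (G.t e) := fun e ↦ decide_eq_true_iff
  rw [max_self] at hM
  have hNM : ∀ e, N e = true → d (G.s e) = M := fun e he ↦
    le_antisymm (hM _) (hk e ((hN e).1 he))
  let κ : Bool × Fin 5 → ℕ := fun w ↦ if w.2 = 0 then 1 else 2
  have hlay := hl.sub_of_level (fun e he ↦ (hN e).1 he) isProfile_completeBipartite rfl rfl
  -- The edges inside layers are exactly those avoiding both ends of `e₀` in a copy, thus edges of a
  -- simple `K_{4,4}`; only the direction needed is recorded.
  have hlev : ∀ g, Sum.elim d (fun p ↦ d (G.s p.1) + κ p.2)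
      ((G.sub N completeBipartite (0, 0)).s g) = Sum.elim d (fun p ↦ d (G.s p.1) + κ p.2)
      ((G.sub N completeBipartite (0, 0)).t g) → ∃ e f, f.1 ≠ 0 ∧ f.2 ≠ 0 ∧ g = .inr (e, f) := by
    rintro (e | ⟨e, f⟩) hg
    · exfalso
      by_cases hNe : N e = true
      · rw [sub_t_inl_of_mem' hNe] at hg
        simp [κ] at hg
        split_ifs at hg
      · rw [sub_t_inl_of_notMem hNe] at hg
        exact hNe ((hN e).2 hg)
    · refine ⟨e, f, ?_⟩
      by_cases hf : f = (0, 0)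
      · exfalso
        subst hf
        rw [sub_t_inr_self, sub_s_inr] at hg
        simp [κ, completeBipartite, (hN e).1 e.2] at hg
      · rw [sub_t_inr_of_ne e hf, sub_s_inr] at hg
        obtain ⟨i, j⟩ := f
        simp only [Sum.elim_inr, κ, completeBipartite] at hg
        split_ifs at hg with h1 h2
        · exact absurd (by rw [h1, h2]) hf
        · omega
        · omega
        · exact ⟨h1, ‹_›, rfl⟩
  refine ⟨_, _, inferInstance, inferInstance, inferInstance, inferInstance,
    G.sub N completeBipartite (0, 0), .inl x, _, _, _, M + 2, h5.sub completeBipartite_isFive,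
    hr.sub (fun e ↦ by simp [N, hr.s_map, hr.t_map, hr.depth_map])
      (fun e w ↦ d (G.s e) + κ w) (fun e _ ↦ by simp [hr.s_map, hr.depth_map]),
    ⟨hlay, ?_, ?_, by omega, ?_⟩, fun hf ↦ hP hf.base_of_sub⟩
  · rintro (v | ⟨e, w⟩)
    · exact (hM v).trans (by omega)
    · have := hNM e e.2
      simp only [Sum.elim_inr, κ]
      split_ifs <;> omega
  · intro g hg
    obtain ⟨e, f, hf, -, rfl⟩ := hlev g hg
    simp [κ, completeBipartite, hf, hNM e e.2]
  · intro g g' hgg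
    by_cases hg : Sum.elim d (fun p ↦ d (G.s p.1) + κ p.2)
      ((G.sub N completeBipartite (0, 0)).s g) = Sum.elim d (fun p ↦ d (G.s p.1) + κ p.2)
      ((G.sub N completeBipartite (0, 0)).t g)
    · have hg' : Sum.elim d (fun p ↦ d (G.s p.1) + κ p.2)
          ((G.sub N completeBipartite (0, 0)).s g') = Sum.elim d (fun p ↦ d (G.s p.1) + κ p.2)
          ((G.sub N completeBipartite (0, 0)).t g') := by
        obtain ⟨h1, h2⟩ | ⟨h1, h2⟩ := hgg
        · rw [← h1, ← h2, hg]
        · rw [← h1, ← h2, hg]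
      obtain ⟨e, f, hf, -, rfl⟩ := hlev g hg
      obtain ⟨e', f', hf', -, rfl⟩ := hlev g' hg'
      have h1 : f ≠ (0, 0) := fun h ↦ hf (by rw [h])
      have h2 : f' ≠ (0, 0) := fun h ↦ hf' (by rw [h])
      rw [Parallel, sub_t_inr_of_ne e h1, sub_t_inr_of_ne e' h2] at hgg
      obtain ⟨i, j⟩ := f
      obtain ⟨i', j'⟩ := f'
      simp [completeBipartite] at hgg ⊢
      tauto
    · exact hlay.eq_of_parallel hgg hg

/-! ### Breadth-first layers. -/

section breadthFirst

variable {V E : Type} (G : OGraph V E)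

/-- There is a walk of length `n` from `x` to `v`. -/
def ReachIn (x : V) : ℕ → V → Prop
  | 0, v => v = x
  | n + 1, v => ∃ e, (G.s e = v ∧ ReachIn x n (G.t e)) ∨ (G.t e = v ∧ ReachIn x n (G.s e))

/-- The distance from `x` to `v`. -/
noncomputable def depth (x v : V) : ℕ := sInf {n | G.ReachIn x n v}

variable {G} {x : V}

theorem exists_reachIn (hc : ∀ P : V → Prop, P x → (∀ e, P (G.s e) ↔ P (G.t e)) → ∀ v, P v)
    (v : V) : ∃ n, G.ReachIn x n v := by
  refine hc (fun v ↦ ∃ n, G.ReachIn x n v) ⟨0, rfl⟩ (fun e ↦ ⟨?_, ?_⟩) v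
  · rintro ⟨n, hn⟩
    exact ⟨n + 1, e, .inr ⟨rfl, hn⟩⟩
  · rintro ⟨n, hn⟩
    exact ⟨n + 1, e, .inl ⟨rfl, hn⟩⟩

theorem depth_le {n : ℕ} {v : V} (h : G.ReachIn x n v) : G.depth x v ≤ n := Nat.sInf_le h

theorem reachIn_depth (hc : ∀ v, ∃ n, G.ReachIn x n v) (v : V) : G.ReachIn x (G.depth x v) v :=
  Nat.sInf_mem (hc v)

theorem depth_eq_zero (hc : ∀ v, ∃ n, G.ReachIn x n v) (v : V) : G.depth x v = 0 ↔ v = x := by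
  constructor
  · intro h
    have := reachIn_depth hc v
    rwa [h] at this
  · intro h
    exact Nat.le_zero.1 (depth_le h)

theorem depth_ends_le (hc : ∀ v, ∃ n, G.ReachIn x n v) (e : E) :
    G.depth x (G.s e) ≤ G.depth x (G.t e) + 1 ∧ G.depth x (G.t e) ≤ G.depth x (G.s e) + 1 :=
  ⟨depth_le ⟨e, .inl ⟨rfl, reachIn_depth hc _⟩⟩, depth_le ⟨e, .inr ⟨rfl, reachIn_depth hc _⟩⟩⟩

theorem exists_down_depth (hc : ∀ v, ∃ n, G.ReachIn x n v) {v : V} (hv : v ≠ x) :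
    ∃ e, G.Down (G.depth x) v e := by
  have h1 := reachIn_depth hc v
  rw [Ne, ← depth_eq_zero hc] at hv
  obtain ⟨n, hn⟩ := Nat.exists_eq_succ_of_ne_zero hv
  rw [hn] at h1
  obtain ⟨e, ⟨h2, h3⟩ | ⟨h2, h3⟩⟩ := h1
  · refine ⟨e, .inl ⟨h2, ?_⟩⟩
    have h4 := depth_le h3
    have h5 := (depth_ends_le hc e).1
    rw [h2] at h5
    omega
  · refine ⟨e, .inr ⟨h2, ?_⟩⟩
    have h4 := depth_le h3
    have h5 := (depth_ends_le hc e).2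
    rw [h2] at h5
    omega

/-- The rotation maps walks from the root to walks from the root; its fourth power is its inverse,
which gives the converse. -/
theorem IsRotation.depth {σ : V → V} {τ : E → E} {d : V → ℕ} (h : G.IsRotation x σ τ d) :
    G.IsRotation x σ τ (G.depth x) := by
  have h1 : ∀ n v, G.ReachIn x n v → G.ReachIn x n (σ v) := by
    intro n
    induction n with
    | zero =>
      rintro v rfl
      exact h.map_root
    | succ n ih =>
      rintro v ⟨e, ⟨rfl, he⟩ | ⟨rfl, he⟩⟩
      · exact ⟨τ e, .inl ⟨h.s_map e, by rw [h.t_map]; exact ih _ he⟩⟩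
      · exact ⟨τ e, .inr ⟨h.t_map e, by rw [h.s_map]; exact ih _ he⟩⟩
  refine { h with depth_map := fun v ↦ congrArg sInf (Set.ext fun n ↦ ⟨fun hn ↦ ?_, h1 n v⟩) }
  have := h1 _ _ (h1 _ _ (h1 _ _ (h1 _ _ hn)))
  rwa [h.iter_vertex] at this

end breadthFirst

/-! ### Invariant parent edges and removal of the other edges between layers. -/

section parent

variable {V E : Type} {G : OGraph V E} {x : V} {σ : V → V} {τ : E → E} {d : V → ℕ}

theorem IsRotation.down_map (h : G.IsRotation x σ τ d) {v : V} {e : E} (he : G.Down d v e) :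
    G.Down d (σ v) (τ e) := by
  simpa only [Down, h.s_map, h.t_map, h.depth_map] using
    he.imp (fun h ↦ ⟨congrArg σ h.1, h.2⟩) (fun h ↦ ⟨congrArg σ h.1, h.2⟩)

theorem IsRotation.exists_parent [Nonempty E] (h : G.IsRotation x σ τ d) {idx : V → Fin 5}
    (hidx : ∀ v, v ≠ x → idx (σ v) = idx v + 1) (hd : ∀ v, v ≠ x → ∃ e, G.Down d v e) :
    ∃ π : V → E, ∀ v, v ≠ x → G.Down d v (π v) ∧ π (σ v) = τ (π v) := by
  choose! π₀ hπ₀ using hd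
  have hdown : ∀ n v e, G.Down d v e → G.Down d (σ^[n] v) (τ^[n] e) := by
    intro n
    induction n with
    | zero => exact fun _ _ h ↦ h
    | succ n ih => exact fun v e he ↦ ih _ _ (h.down_map he)
  have hne : ∀ v, v ≠ x → σ v ≠ x := by
    intro v hv hσ
    apply hv
    rw [← h.iter_vertex v, hσ]
    simp [h.map_root]
  have hne' : ∀ n v, v ≠ x → σ^[n] v ≠ x := by
    intro n
    induction n with
    | zero => exact fun _ h ↦ h
    | succ n ih => exact fun v hv ↦ ih _ (hne v hv)
  -- The vertex `σ^[5 - idx v] v` represents the orbit of `v` at index `0`; its chosen edge is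
  -- rotated back to `v`.
  refine ⟨fun v ↦ τ^[idx v] (π₀ (σ^[5 - idx v] v)), fun v hv ↦ ⟨?_, ?_⟩⟩
  · have h1 := hdown (idx v) _ _ (hπ₀ _ (hne' (5 - idx v) v hv))
    rw [← Function.iterate_add_apply] at h1
    rwa [show (idx v : ℕ) + (5 - idx v) = 5 by omega, show σ^[5] v = v from h.iter_vertex v] at h1
  · simp only [hidx v hv]
    generalize idx v = i
    fin_cases i <;> simp [h.iter_vertex, h.iter_edge]

variable [Fintype V] [Fintype E] [DecidableEq V] [DecidableEq E]

/-- `N` consists of the edges between consecutive layers that are not the parent edge of their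
deeper end. It is invariant because `π` commutes with the rotation away from the root. -/
theorem IsFive.exists_isStage (h5 : G.IsFive) (hr : G.IsRotation x σ τ d)
    (h0 : ∀ v, d v = 0 ↔ v = x)
    (hd : ∀ e, d (G.s e) ≤ d (G.t e) + 1 ∧ d (G.t e) ≤ d (G.s e) + 1)
    {π : V → E} (hπ : ∀ v, v ≠ x → G.Down d v (π v) ∧ π (σ v) = τ (π v)) :
    ∃ M, IsStage M 0 G.HasFlow := by
  let N : E → Bool := fun e ↦ decide ((d (G.s e) = d (G.t e) + 1 ∧ π (G.s e) ≠ e) ∨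
    (d (G.t e) = d (G.s e) + 1 ∧ π (G.t e) ≠ e))
  have hN : ∀ e, N e = true ↔ (d (G.s e) = d (G.t e) + 1 ∧ π (G.s e) ≠ e) ∨
    (d (G.t e) = d (G.s e) + 1 ∧ π (G.t e) ≠ e) := fun e ↦ decide_eq_true_iff
  have hτ : ∀ e e', τ e = τ e' ↔ e = e' := by
    refine fun e e' ↦ ⟨fun hee ↦ ?_, congrArg τ⟩
    rw [← hr.iter_edge e, hee, hr.iter_edge]
  have hNτ : ∀ e, N (τ e) = N e := by
    intro e
    simp only [N, hr.s_map, hr.t_map, hr.depth_map]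
    congr 1
    refine propext (or_congr (and_congr_right fun h1 ↦ ?_) (and_congr_right fun h1 ↦ ?_))
    · rw [(hπ (G.s e) (by rw [Ne, ← h0]; omega)).2, Ne, hτ]
    · rw [(hπ (G.t e) (by rw [Ne, ← h0]; omega)).2, Ne, hτ]
  -- Depths in a copy are counted from the shallower end of `e`. The tail of `e` is joined to the
  -- target `some 1` of `e₀`, so `some 1` is the front vertex when the tail is shallower, and `some
  -- 0` otherwise.
  let l : E → ℕ := fun e ↦ min (d (G.s e)) (d (G.t e))
  let i : E → Fin 5 := fun e ↦ if d (G.s e) < d (G.t e) then 1 else 0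
  let κ : E → Option (Fin 5) → ℕ := fun e w ↦ if w = some (i e) then 1 else 2
  have hi : ∀ e, i e = 0 ∨ i e = 1 := fun e ↦ by
    simp only [i]
    split_ifs <;> simp
  have hl := IsLayered.sub (N := N) (Q := completeSix) (e₀ := (0, 1)) (l := l) (κ := κ) h0
    (fun e _ ↦ hd e) (fun v hv ↦ ?_) (fun e _ ↦ isProfile_completeSix _ (hi e))
    (fun e he ↦ ?_) (fun e he ↦ ?_)
  · obtain ⟨M, hM⟩ := (Set.finite_range (Sum.elim d fun p : {e // N e = true} × Option (Fin 5) ↦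
      l p.1 + κ p.1 p.2)).bddAbove
    exact ⟨M, _, _, inferInstance, inferInstance, inferInstance, inferInstance,
      G.sub N completeSix (0, 1), .inl x, _, _, _, h5.sub completeSix_isFive,
      hr.sub hNτ (fun e w ↦ l e + κ e w) (fun e w ↦ by
        simp [l, κ, i, hr.s_map, hr.t_map, hr.depth_map]), hl,
      fun v ↦ (hM ⟨v, rfl⟩).trans (le_max_left _ _), fun _ _ ↦ Nat.zero_le _,
      fun hf ↦ hf.base_of_sub⟩
  · refine ⟨π v, ⟨?_, (hπ v hv).1⟩, ?_⟩
    · rw [Ne, hN]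
      obtain ⟨h1, h2⟩ | ⟨h1, h2⟩ := (hπ v hv).1
      · rw [h1]
        rintro (⟨-, h3⟩ | ⟨h3, -⟩)
        · exact h3 rfl
        · omega
      · rw [h1]
        rintro (⟨h3, -⟩ | ⟨-, h3⟩)
        · omega
        · exact h3 rfl
    · rintro e ⟨h1, h2⟩
      rw [Ne, hN] at h1
      obtain ⟨rfl, h3⟩ | ⟨rfl, h3⟩ := h2
      · by_contra h4
        exact h1 (.inl ⟨h3.symm, Ne.symm h4⟩)
      · by_contra h4
        exact h1 (.inr ⟨h3.symm, Ne.symm h4⟩)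
  · rw [hN] at he
    by_cases hlt : d (G.s e) < d (G.t e)
    · simp [l, κ, i, completeSix, hlt, hlt.le]
    · simp [l, κ, i, completeSix, hlt]
      omega
  · rw [hN] at he
    by_cases hlt : d (G.s e) < d (G.t e)
    · simp [l, κ, i, completeSix, hlt]
      omega
    · simp [l, κ, i, completeSix, hlt]
      omega

end parent

/-! ### Building a connected `5`-graph into one with a rotation. -/

theorem isRotation_completeSix : completeSix.IsRotation none (Option.map (· + 1))
    (fun e ↦ (e.1 + 1, e.2)) fun _ ↦ 0 where
  s_map := by decide
  t_map := by decide
  iter_vertex := by decide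
  iter_edge := by decide
  map_root := by decide
  eq_root := by decide
  depth_map := by decide

/-- The edges of `K₆` from `some i` to `some (i + 1)` form one orbit and are replaced by copies of
`Q - e₀`. The spokes at the root remain, so all base vertices are connected to it; both ends of `e₀`
in a copy are attached to base vertices, so deleting `e₀` does no harm to connectedness. -/
theorem IsFive.exists_isStage_of_connected {W F : Type} [Fintype W] [Fintype F] [DecidableEq W]
    [DecidableEq F] {Q : OGraph W F} (hQ : Q.IsFive) (e₀ : F)
    (hc : ∀ P : W → Prop, (∀ e, P (Q.s e) ↔ P (Q.t e)) → ∀ u v, P u → P v) :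
    ∃ M, IsStage M 0 Q.HasFlow := by
  let N : Fin 5 × Fin 3 → Bool := fun e ↦ decide (e.2 = 1)
  have h5 : (completeSix.sub N Q e₀).IsFive := completeSix_isFive.sub hQ
  have hr := (isRotation_completeSix.sub (N := N) (Q := Q) (e₀ := e₀) (fun e ↦ rfl)
    (fun _ _ ↦ 0) (fun _ _ ↦ rfl)).depth
  have hreach := exists_reachIn (G := completeSix.sub N Q e₀) (x := .inl none) (by
    intro P hx hP
    have h1 : ∀ v, P (.inl v) := by
      rintro (_ | j)
      · exact hx
      · exact (hP (.inl (j, 0))).2 hx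
    rintro (v | ⟨e, w⟩)
    · exact h1 v
    · have hs : P (.inr (e, Q.s e₀)) := by
        refine (hP (.inr (e, e₀))).2 ?_
        rw [sub_t_inr_self]
        exact h1 _
      have ht : P (.inr (e, Q.t e₀)) := by
        rw [← sub_t_inl_of_mem (G := completeSix) (Q := Q) (e₀ := e₀)]
        exact (hP (.inl e.1)).1 (h1 _)
      refine hc (fun w ↦ P (.inr (e, w))) (fun f ↦ ?_) _ w hs
      by_cases hf : f = e₀
      · subst hf
        exact iff_of_true hs ht
      · simpa [sub_t_inr_of_ne e hf] using hP (.inr (e, f)))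
  have hne : Nonempty (Fin 5 × Fin 3 ⊕ {e // N e = true} × F) := ⟨.inl (0, 0)⟩
  -- A rim vertex has its own index, a vertex of a copy the index of the replaced edge; the value
  -- `0` at the root is a default.
  obtain ⟨π, hπ⟩ := hr.exists_parent
    (idx := Sum.elim (fun v ↦ v.elim 0 id) fun p ↦ p.1.1.1) (by
      rintro ((_ | j) | ⟨e, w⟩) hv
      · exact absurd rfl hv
      · rfl
      · rfl) (fun v hv ↦ exists_down_depth hreach hv)
  obtain ⟨M, hM⟩ := h5.exists_isStage hr (depth_eq_zero hreach) (depth_ends_le hreach) hπ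
  obtain ⟨V, E, i1, i2, i3, i4, G, x, σ, τ, d, g1, g2, g3, g4, g5, g6⟩ := hM
  exact ⟨M, V, E, i1, i2, i3, i4, G, x, σ, τ, d, g1, g2, g3, g4, g5,
    fun h ↦ (g6 h).gadget_of_sub ⟨(0, 1), rfl⟩⟩

end OGraph

/-! ### Recognising the spanning tree from its layers. -/

/-- Following downward edges gives connectedness, and sending each `v ≠ x` to its downward edge is a
bijection onto the edges, so the edge count is that of a tree. Depth changes by one along each edge
and is therefore the distance from `x`. The condition `r ≠ 1` confines leaves to layer `D`. -/
theorem Graph.isBalancedTree_of_layers {V : Type u} [Finite V] {T : SimpleGraph V} {x : V}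
    {d : V → ℕ} {r D : ℕ} (h0 : ∀ v, d v = 0 ↔ v = x)
    (hadj : ∀ v w, T.Adj v w → d v = d w + 1 ∨ d w = d v + 1)
    (hdown : ∀ v, v ≠ x → ∃! w, T.Adj v w ∧ d w + 1 = d v) (hr : r ≠ 1)
    (hdeg : ∀ v, d v ≠ D → (T.neighborSet v).ncard = r)
    (hleaf : ∀ v, d v = D → (T.neighborSet v).ncard = 1) :
    Graph.IsBalancedTree r D T x := by
  have hwalk : ∀ n v, d v = n → ∃ p : T.Walk v x, p.length = n := by
    intro n
    induction n with
    | zero =>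
      intro v hv
      obtain rfl := (h0 v).1 hv
      exact ⟨.nil, rfl⟩
    | succ n ih =>
      intro v hv
      obtain ⟨w, ⟨h1, h2⟩, -⟩ := hdown v (by rw [Ne, ← h0]; omega)
      obtain ⟨p, hp⟩ := ih w (by omega)
      exact ⟨.cons h1 p, by simp [hp]⟩
  have hlen : ∀ v w (p : T.Walk v w), d v ≤ p.length + d w := by
    intro v w p
    induction p with
    | nil => simp
    | cons h p ih =>
      have := hadj _ _ h
      rw [SimpleGraph.Walk.length_cons]
      omega
  have hreach : ∀ v, T.Reachable v x := fun v ↦ (hwalk _ v rfl).choose.reachable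
  have hconn : T.Connected := by
    have : Nonempty V := ⟨x⟩
    exact ⟨fun v w ↦ (hreach v).trans (hreach w).symm⟩
  refine ⟨?_, ?_, ?_⟩
  · refine SimpleGraph.isTree_iff_connected_and_card.2 ⟨hconn, ?_⟩
    choose! p hp huniq using hdown
    have hb : Function.Bijective fun v : {v // v ≠ x} ↦
        (⟨s(v.1, p v.1), (hp v.1 v.2).1⟩ : T.edgeSet) := by
      constructor
      · rintro ⟨v, hv⟩ ⟨w, hw⟩ hvw
        rw [Subtype.mk.injEq]
        obtain ⟨h, -⟩ | ⟨h1, h2⟩ := Sym2.eq_iff.1 (congrArg Subtype.val hvw)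
        · exact h
        · have h3 : d (p v) + 1 = d v := (hp v hv).2
          have h4 : d (p w) + 1 = d w := (hp w hw).2
          change p v = w at h2
          change v = p w at h1
          rw [h2] at h3
          rw [← h1] at h4
          omega
      · rintro ⟨e, he⟩
        induction e with
        | h v w =>
          rw [SimpleGraph.mem_edgeSet] at he
          obtain h | h := hadj v w he
          · have hv : v ≠ x := by rw [Ne, ← h0]; omega
            exact ⟨⟨v, hv⟩, Subtype.ext (congrArg (s(v, ·)) (huniq v hv w ⟨he, h.symm⟩).symm)⟩
          · have hw : w ≠ x := by rw [Ne, ← h0]; omega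
            exact ⟨⟨w, hw⟩, Subtype.ext ((congrArg (s(w, ·))
              (huniq w hw v ⟨he.symm, h.symm⟩).symm).trans Sym2.eq_swap)⟩
    rw [← Nat.card_congr (Equiv.ofBijective _ hb)]
    have h1 := Set.ncard_add_ncard_compl ({x} : Set V)
    rw [Set.ncard_singleton] at h1
    rw [← h1, add_comm]
    rfl
  · intro v
    by_cases hv : d v = D
    · exact .inl (hleaf v hv)
    · exact .inr (hdeg v hv)
  · intro v hv
    have hvD : d v = D := by
      by_contra h
      exact hr ((hdeg v h).symm.trans hv)
    rw [SimpleGraph.dist_comm]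
    refine le_antisymm ?_ ?_
    · obtain ⟨p, hp⟩ := hwalk _ v rfl
      exact (SimpleGraph.dist_le p).trans (by omega)
    · obtain ⟨p, hp⟩ := (hreach v).exists_walk_length_eq_dist
      have h1 := hlen _ _ p
      rw [(h0 x).2 rfl] at h1
      omega

namespace OGraph

section tree

variable {V E : Type} {G : OGraph V E}

/-- The edge `e` joins `u` and `v`. -/
def Joins (G : OGraph V E) (e : E) (u v : V) : Prop :=
  (G.s e = u ∧ G.t e = v) ∨ (G.s e = v ∧ G.t e = u)

theorem Joins.symm {e : E} {u v : V} (h : G.Joins e u v) : G.Joins e v u := Or.symm h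

theorem Joins.parallel {e e' : E} {u v : V} (h : G.Joins e u v) (h' : G.Joins e' u v) :
    G.Parallel e e' := by
  obtain ⟨rfl, rfl⟩ | ⟨rfl, rfl⟩ := h <;> obtain ⟨h1, h2⟩ | ⟨h1, h2⟩ := h'
  · exact .inl ⟨h1.symm, h2.symm⟩
  · exact .inr ⟨h2.symm, h1.symm⟩
  · exact .inr ⟨h2.symm, h1.symm⟩
  · exact .inl ⟨h1.symm, h2.symm⟩

theorem down_iff {d : V → ℕ} {v : V} {e : E} :
    G.Down d v e ↔ ∃ w, G.Joins e v w ∧ d w + 1 = d v := by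
  constructor
  · rintro (⟨h1, h2⟩ | ⟨h1, h2⟩)
    · exact ⟨_, .inl ⟨h1, rfl⟩, h2⟩
    · exact ⟨_, .inr ⟨rfl, h1⟩, h2⟩
  · rintro ⟨w, ⟨h1, rfl⟩ | ⟨rfl, h1⟩, h2⟩
    · exact .inl ⟨h1, h2⟩
    · exact .inr ⟨h1, h2⟩

/-- The edges of `G` between different layers. -/
def layerTree (G : OGraph V E) (d : V → ℕ) : SimpleGraph V where
  Adj u v := (∃ e, G.Joins e u v) ∧ d u ≠ d v
  symm := ⟨fun _ _ h ↦ ⟨h.1.imp fun _ h ↦ h.symm, h.2.symm⟩⟩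
  loopless := ⟨fun _ h ↦ h.2 rfl⟩

variable {x : V} {d : V → ℕ} {D : ℕ}

theorem IsLayered.depth_of_adj (h : G.IsLayered x d) {v w : V} (hvw : (G.layerTree d).Adj v w) :
    d v = d w + 1 ∨ d w = d v + 1 := by
  obtain ⟨⟨e, ⟨rfl, rfl⟩ | ⟨rfl, rfl⟩⟩, h1⟩ := hvw <;> have := h.depth_le e <;> omega

theorem IsLayered.existsUnique_adj (h : G.IsLayered x d) {v : V} (hv : v ≠ x) :
    ∃! w, (G.layerTree d).Adj v w ∧ d w + 1 = d v := by
  obtain ⟨e, he, huniq⟩ := h.existsUnique_down v hv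
  obtain ⟨w, h1, h2⟩ := down_iff.1 he
  refine ⟨w, ⟨⟨⟨e, h1⟩, by omega⟩, h2⟩, ?_⟩
  rintro w' ⟨⟨⟨e', h3⟩, -⟩, h4⟩
  obtain rfl := huniq e' (down_iff.2 ⟨w', h3, h4⟩)
  have := G.ne e'
  obtain ⟨rfl, rfl⟩ | ⟨rfl, rfl⟩ := h1 <;> obtain ⟨h5, rfl⟩ | ⟨rfl, h5⟩ := h3
  · rfl
  · exact absurd h5.symm this
  · exact absurd h5 this
  · rfl

theorem IsTreeLayered.ncard_neighborSet_last (h : G.IsTreeLayered x d D) {v : V} (hv : d v = D) :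
    ((G.layerTree d).neighborSet v).ncard = 1 := by
  have hvx : v ≠ x := by
    rw [Ne, ← h.depth_eq_zero, hv]
    exact h.pos.ne'
  obtain ⟨w, hw, huniq⟩ := h.toIsLayered.existsUnique_adj hvx
  rw [Set.ncard_eq_one]
  refine ⟨w, Set.ext fun w' ↦ ⟨fun h1 ↦ huniq w' ⟨h1, ?_⟩, ?_⟩⟩
  · have h2 := h.toIsLayered.depth_of_adj h1
    have h3 := h.depth_le_last w'
    omega
  · rintro rfl
    exact hw.1

variable [Fintype V] [Fintype E] [DecidableEq V] [DecidableEq E]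

theorem ncard_incident (G : OGraph V E) (v : V) :
    {e | G.s e = v ∨ G.t e = v}.ncard = G.outSum (fun _ ↦ 1) v + G.inSum (fun _ ↦ 1) v := by
  have h1 : {e | G.s e = v ∨ G.t e = v} =
      ((Finset.univ.filter (G.s · = v) ∪ Finset.univ.filter (G.t · = v) : Finset E) : Set E) := by
    ext e
    simp
  rw [h1, Set.ncard_coe_finset, Finset.card_union_of_disjoint]
  · simp [outSum, inSum]
  · rw [Finset.disjoint_filter]
    rintro e - h2 h3
    exact G.ne e (h2.trans h3.symm)

/-- Before the last layer no edge stays inside its layer and none are parallel, so the tree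
neighbours of `v` correspond to the five edges at `v`. -/
theorem IsTreeLayered.ncard_neighborSet (h : G.IsTreeLayered x d D) (hG : G.Regular) {v : V}
    (hv : d v ≠ D) : ((G.layerTree d).neighborSet v).ncard = 5 := by
  rw [← hG v, ← ncard_incident]
  have h1 : (G.layerTree d).neighborSet v =
      (fun e ↦ if G.s e = v then G.t e else G.s e) '' {e | G.s e = v ∨ G.t e = v} := by
    ext w
    rw [SimpleGraph.mem_neighborSet, Set.mem_image]
    constructor
    · rintro ⟨⟨e, ⟨rfl, rfl⟩ | ⟨rfl, rfl⟩⟩, -⟩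
      · exact ⟨e, .inl rfl, by simp⟩
      · exact ⟨e, .inr rfl, by simp [G.ne e]⟩
    · rintro ⟨e, rfl | rfl, rfl⟩
      · refine ⟨⟨e, .inl (by simp)⟩, ?_⟩
        simp only [if_true]
        exact fun h2 ↦ hv (h.depth_of_level e h2)
      · refine ⟨⟨e, .inr (by simp [G.ne e])⟩, ?_⟩
        simp only [G.ne e, if_false]
        exact fun h2 ↦ hv (h2.trans (h.depth_of_level e h2.symm))
  rw [h1]
  refine Set.InjOn.ncard_image ?_
  intro e he e' he' hee
  refine h.eq_of_parallel e e' ?_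
  have key : ∀ e, G.s e = v ∨ G.t e = v → G.Joins e v (if G.s e = v then G.t e else G.s e) := by
    rintro e (h2 | h2)
    · exact .inl (by simp [h2])
    · refine .inr ⟨?_, h2⟩
      rw [if_neg]
      rw [← h2]
      exact G.ne e
  have h3 := key e he
  have h4 := key e' he'
  simp only at hee
  rw [← hee] at h4
  exact h3.parallel h4

end tree

/-! ### Translation to and from `Graph`. -/

section represents

variable {V E : Type} {α : Type u} {β : Type v}

/-- `G` and `H` are the same graph, up to the orientation of `G`. -/
def Represents (G : OGraph V E) (H : Graph α β) (φ : V ≃ H.vertexSet) (ψ : E ≃ H.edgeSet) : Prop :=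
  ∀ e, H.IsLink (ψ e) (φ (G.s e)) (φ (G.t e))

variable {G : OGraph V E} {H : Graph α β} {φ : V ≃ H.vertexSet} {ψ : E ≃ H.edgeSet}

theorem Represents.isLink_iff (h : G.Represents H φ ψ) {e : E} {u v : V} :
    H.IsLink (ψ e) (φ u) (φ v) ↔ G.Joins e u v := by
  rw [(h e).isLink_iff]
  simp [Joins, ← Subtype.ext_iff]

theorem Represents.isLink_iff_exists (h : G.Represents H φ ψ) {b : β} {u v : V} :
    H.IsLink b (φ u) (φ v) ↔ ∃ e, G.Joins e u v ∧ (ψ e : β) = b := by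
  constructor
  · intro hb
    refine ⟨ψ.symm ⟨b, hb.edge_mem⟩, ?_, by simp⟩
    rw [← h.isLink_iff]
    simpa using hb
  · rintro ⟨e, he, rfl⟩
    exact h.isLink_iff.2 he

theorem coe_edge_injective (ψ : E ≃ H.edgeSet) : Function.Injective fun e ↦ (ψ e : β) :=
  Subtype.val_injective.comp ψ.injective

variable [Fintype V] [Fintype E] [DecidableEq V] [DecidableEq E]

theorem Represents.ncard_incidenceSet (h : G.Represents H φ ψ) (v : V) :
    (H.incidenceSet (φ v)).ncard = G.outSum (fun _ ↦ 1) v + G.inSum (fun _ ↦ 1) v := by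
  rw [← ncard_incident, ← Set.ncard_image_of_injective _ (coe_edge_injective ψ)]
  congr 1
  ext b
  simp only [Graph.incidenceSet, Set.mem_ofPred_eq, Set.mem_image]
  constructor
  · rintro ⟨y, hy⟩
    have hy' : H.IsLink b (φ v) (φ (φ.symm ⟨y, hy.right_mem⟩)) := by simpa using hy
    obtain ⟨e, ⟨h1, -⟩ | ⟨-, h1⟩, rfl⟩ := h.isLink_iff_exists.1 hy'
    · exact ⟨e, .inl h1, rfl⟩
    · exact ⟨e, .inr h1, rfl⟩
  · rintro ⟨e, rfl | rfl, rfl⟩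
    · exact ⟨_, h e⟩
    · exact ⟨_, (h e).symm⟩

theorem Represents.ncard_edgeBoundary (h : G.Represents H φ ψ) (S : V → Bool) :
    (H.edgeBoundary ((fun v ↦ (φ v : α)) '' {v | S v = true})).ncard = (G.cut S).card := by
  rw [← Set.ncard_coe_finset, ← Set.ncard_image_of_injective _ (coe_edge_injective ψ)]
  congr 1
  have hinj : Function.Injective fun v ↦ (φ v : α) := Subtype.val_injective.comp φ.injective
  ext b
  simp only [Graph.edgeBoundary, Set.mem_ofPred_eq, Set.mem_image, Finset.mem_coe, mem_cut]
  constructor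
  · rintro ⟨_, ⟨u, hu, rfl⟩, y, hy, hb⟩
    have hb' : H.IsLink b (φ u) (φ (φ.symm ⟨y, hb.right_mem⟩)) := by simpa using hb
    obtain ⟨e, he, rfl⟩ := h.isLink_iff_exists.1 hb'
    have hw : S (φ.symm ⟨y, hb.right_mem⟩) ≠ true := fun hS ↦ hy ⟨_, hS, by simp⟩
    refine ⟨e, ?_, rfl⟩
    obtain ⟨h1, h2⟩ | ⟨h1, h2⟩ := he
    · rw [h1, h2, hu]
      exact hw.symm
    · rw [h1, h2, hu]
      exact hw
  · rintro ⟨e, he, rfl⟩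
    by_cases hs : S (G.s e) = true
    · refine ⟨_, ⟨_, hs, rfl⟩, φ (G.t e), ?_, h e⟩
      rintro ⟨w, hw, hwt⟩
      rw [hinj hwt] at hw
      exact he (hs.trans hw.symm)
    · refine ⟨_, ⟨G.t e, ?_, rfl⟩, φ (G.s e), ?_, (h e).symm⟩
      · revert he hs
        cases S (G.s e) <;> cases S (G.t e) <;> simp
      · rintro ⟨w, hw, hwt⟩
        rw [hinj hwt] at hw
        exact hs hw

theorem Represents.isRGraph_iff (h : G.Represents H φ ψ) : H.IsRGraph 5 ↔ G.IsFive := by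
  have hsupp : ∀ S : V → Bool,
      ((fun v ↦ (φ v : α)) '' {v | S v = true}).ncard = (supp S).card := by
    intro S
    have hinj : Function.Injective fun v ↦ (φ v : α) := Subtype.val_injective.comp φ.injective
    rw [Set.ncard_image_of_injective _ hinj, ← Set.ncard_coe_finset]
    congr 1
    ext v
    simp [supp]
  constructor
  · intro hH
    refine ⟨fun v ↦ ?_, fun S hS ↦ ?_⟩
    · rw [← h.ncard_incidenceSet]
      exact hH.degree_eq _ (φ v).2
    · rw [← h.ncard_edgeBoundary]
      refine hH.le_edgeBoundary _ ?_ (by rwa [hsupp])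
      rintro _ ⟨v, -, rfl⟩
      exact (φ v).2
  · intro hG
    refine ⟨⟨?_, ?_, ⟨?_⟩, ?_⟩, ?_⟩
    · have := Finite.of_equiv _ φ
      exact Set.toFinite _
    · have := Finite.of_equiv _ ψ
      exact Set.toFinite _
    · intro b y hb
      have hb' : H.IsLink b (φ (φ.symm ⟨y, hb.inc.vertex_mem⟩))
          (φ (φ.symm ⟨y, hb.inc.vertex_mem⟩)) := by simpa using hb
      obtain ⟨e, ⟨h1, h2⟩ | ⟨h1, h2⟩, rfl⟩ := h.isLink_iff_exists.1 hb' <;>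
        exact G.ne e (h1.trans h2.symm)
    · intro y hy
      have := h.ncard_incidenceSet (φ.symm ⟨y, hy⟩)
      rw [hG.regular] at this
      simpa using this
    · intro S hS hodd
      classical
      let χ : V → Bool := fun v ↦ decide ((φ v : α) ∈ S)
      have hχ : (fun v ↦ (φ v : α)) '' {v | χ v = true} = S := by
        ext y
        simp only [χ, decide_eq_true_eq, Set.mem_image, Set.mem_ofPred_eq]
        constructor
        · rintro ⟨v, hv, rfl⟩
          exact hv
        · intro hy
          exact ⟨φ.symm ⟨y, hS hy⟩, by simpa using hy, by simp⟩
      rw [← hχ, h.ncard_edgeBoundary]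
      exact hG.le_cut _ (by rwa [← hsupp, hχ])

theorem finsum_edge (ψ : E ≃ H.edgeSet) (f : H.edgeSet → ℤ) (p : H.edgeSet → Prop)
    [DecidablePred p] : ∑ᶠ e ∈ {e | p e}, f e = ∑ e, if p (ψ e) then f (ψ e) else 0 := by
  rw [finsum_mem_def, ← finsum_comp_equiv ψ, finsum_eq_sum_of_fintype]
  refine Finset.sum_congr rfl fun e _ ↦ ?_
  simp [Set.indicator_apply]

theorem Represents.hasFlow (h : G.Represents H φ ψ) (hH : H.HasNowhereZeroFlow 3) :
    G.HasFlow := by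
  classical
  obtain ⟨O, f, h0, hf⟩ := hH
  have hends : ∀ e, (O.tail (ψ e) = φ (G.s e) ∧ O.head (ψ e) = φ (G.t e)) ∨
      (O.tail (ψ e) = φ (G.t e) ∧ O.head (ψ e) = φ (G.s e)) := by
    intro e
    obtain ⟨h1, h2⟩ | ⟨h1, h2⟩ := (O.isLink (ψ e)).eq_and_eq_or_eq_and_eq (h e)
    · exact .inl ⟨Subtype.ext h1, Subtype.ext h2⟩
    · exact .inr ⟨Subtype.ext h1, Subtype.ext h2⟩
  -- The sign is reversed where the orientation `O` disagrees with that of `G`.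
  refine ⟨fun e ↦ if O.tail (ψ e) = φ (G.s e) then f (ψ e) else -f (ψ e), fun e ↦ ?_, fun v ↦ ?_⟩
  · have := h0 (ψ e)
    dsimp only
    split_ifs
    · exact this
    · simpa using this
  · have h1 := hf (φ v)
    rw [finsum_edge ψ, finsum_edge ψ] at h1
    rw [← sub_eq_zero] at h1 ⊢
    rw [← neg_eq_zero, ← h1, outSum, inSum, ← Finset.sum_sub_distrib, ← Finset.sum_sub_distrib,
      ← Finset.sum_neg_distrib]
    refine Finset.sum_congr rfl fun e _ ↦ ?_
    have hne := G.ne e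
    obtain ⟨h2, h3⟩ | ⟨h2, h3⟩ := hends e
    · simp [h2, h3]
    · simp [h2, h3, hne.symm]
      split_ifs <;> simp

theorem Represents.hasNowhereZeroFlow (h : G.Represents H φ ψ) (hG : G.HasFlow) :
    H.HasNowhereZeroFlow 3 := by
  classical
  obtain ⟨f, h0, hf⟩ := hG
  refine ⟨⟨fun e ↦ φ (G.s (ψ.symm e)), fun e ↦ φ (G.t (ψ.symm e)), fun e ↦ ?_⟩,
    fun e ↦ f (ψ.symm e), fun e ↦ h0 _, fun y ↦ ?_⟩
  · simpa using h (ψ.symm e)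
  · rw [finsum_edge ψ, finsum_edge ψ]
    have := hf (φ.symm y)
    simp only [outSum, inSum, Equiv.eq_symm_apply] at this
    simpa using this.symm

theorem Represents.simple (h : G.Represents H φ ψ) (hp : ∀ e e', G.Parallel e e' → e = e') :
    H.Simple where
  not_isLoopAt b y hb := by
    have hb' : H.IsLink b (φ (φ.symm ⟨y, hb.inc.vertex_mem⟩))
        (φ (φ.symm ⟨y, hb.inc.vertex_mem⟩)) := by simpa using hb
    obtain ⟨e, ⟨h1, h2⟩ | ⟨h1, h2⟩, rfl⟩ := h.isLink_iff_exists.1 hb' <;>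
      exact G.ne e (h1.trans h2.symm)
  eq_of_isLink b b' y z hb hb' := by
    have h1 : H.IsLink b (φ (φ.symm ⟨y, hb.left_mem⟩)) (φ (φ.symm ⟨z, hb.right_mem⟩)) := by
      simpa using hb
    have h2 : H.IsLink b' (φ (φ.symm ⟨y, hb.left_mem⟩)) (φ (φ.symm ⟨z, hb.right_mem⟩)) := by
      simpa using hb'
    obtain ⟨e, he, rfl⟩ := h.isLink_iff_exists.1 h1
    obtain ⟨e', he', rfl⟩ := h.isLink_iff_exists.1 h2
    rw [hp e e' (he.parallel he')]

theorem Represents.isRotationRGraph {x : V} {σ : V → V} {τ : E → E} {d : V → ℕ} {D : ℕ}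
    (h : G.Represents H φ ψ) (h5 : G.IsFive) (hr : G.IsRotation x σ τ d)
    (hl : G.IsTreeLayered x d D) : H.IsRotationRGraph 5 := by
  have hH := h.isRGraph_iff.2 h5
  have hfin : Finite H.vertexSet := Finite.of_equiv _ φ
  let a : Equiv.Perm V := ⟨σ, fun v ↦ σ (σ (σ (σ v))), hr.iter_vertex, hr.iter_vertex⟩
  let b : Equiv.Perm E := ⟨τ, fun v ↦ τ (τ (τ (τ v))), hr.iter_edge, hr.iter_edge⟩
  have ha : ∀ v, a v = σ v := fun _ ↦ rfl
  have hb : ∀ e, τ (b.symm e) = e := b.apply_symm_apply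
  have hjoins : ∀ e u v, G.Joins (τ e) (σ u) (σ v) ↔ G.Joins e u v := by
    intro e u v
    simp only [Joins, hr.s_map, hr.t_map, ← ha, a.injective.eq_iff]
  let T : SimpleGraph H.vertexSet := (G.layerTree d).comap φ.symm
  have hnb : ∀ y, (T.neighborSet y).ncard = ((G.layerTree d).neighborSet (φ.symm y)).ncard := by
    intro y
    rw [← Set.ncard_image_of_injective _ φ.injective]
    congr 1
    ext z
    simp only [SimpleGraph.mem_neighborSet, Set.mem_image, T, SimpleGraph.comap_adj]
    constructor
    · exact fun hz ↦ ⟨_, hz, by simp⟩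
    · rintro ⟨w, hw, rfl⟩
      simpa using hw
  have hroot : (T.neighborSet (φ x)).ncard = 5 := by
    rw [hnb, φ.symm_apply_apply]
    refine hl.ncard_neighborSet h5.regular ?_
    rw [(hl.depth_eq_zero x).2 rfl]
    exact hl.pos.ne
  refine ⟨hH, D, hH.toIsRegularMultigraph, T, φ x, (φ.symm.trans a).trans φ, ?_, ?_, ?_, ?_, ?_, ?_⟩
  · rintro y z ⟨⟨e, he⟩, -⟩
    refine ⟨ψ e, ?_⟩
    simpa using h.isLink_iff.2 he
  · refine Graph.isBalancedTree_of_layers (d := fun y ↦ d (φ.symm y)) (fun y ↦ ?_)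
      (fun y z hyz ↦ hl.toIsLayered.depth_of_adj hyz) (fun y hy ↦ ?_) (by norm_num)
      (fun y hy ↦ ?_) (fun y hy ↦ ?_)
    · rw [hl.depth_eq_zero, Equiv.symm_apply_eq]
    · have hy' : φ.symm y ≠ x := by rwa [Ne, Equiv.symm_apply_eq]
      obtain ⟨w, hw, huniq⟩ := hl.toIsLayered.existsUnique_adj hy'
      refine ⟨φ w, by simpa [T] using hw, fun z hz ↦ ?_⟩
      rw [← huniq (φ.symm z) hz, φ.apply_symm_apply]
    · rw [hnb, hl.ncard_neighborSet h5.regular hy]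
    · rw [hnb, hl.ncard_neighborSet_last hy]
  · intro y z
    have key : ∀ u v, {e | H.IsLink e (φ u) (φ v)}.ncard = {e | G.Joins e u v}.ncard := by
      intro u v
      rw [← Set.ncard_image_of_injective _ (coe_edge_injective ψ)]
      congr 1
      ext e
      simp [h.isLink_iff_exists]
    have h1 := key (φ.symm y) (φ.symm z)
    rw [φ.apply_symm_apply, φ.apply_symm_apply] at h1
    rw [h1]
    refine Eq.trans ?_ (key (σ (φ.symm y)) (σ (φ.symm z))).symm
    rw [← Set.ncard_image_of_injective _ b.injective]
    congr 1
    ext e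
    rw [Set.mem_image]
    constructor
    · rintro ⟨e, he, rfl⟩
      exact (hjoins e _ _).2 he
    · intro he
      refine ⟨b.symm e, (hjoins _ _ _).1 ?_, b.apply_symm_apply e⟩
      rwa [hb]
  · intro y z
    simp only [T, SimpleGraph.comap_adj, Equiv.trans_apply, φ.symm_apply_apply, layerTree, ha,
      hr.depth_map]
    refine and_congr_left fun _ ↦ ⟨?_, fun ⟨e, he⟩ ↦ ⟨τ e, (hjoins _ _ _).2 he⟩⟩
    rintro ⟨e, he⟩
    refine ⟨b.symm e, (hjoins _ _ _).1 ?_⟩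
    rwa [hb]
  · rw [Function.minimalPeriod_eq_one_iff_isFixedPt]
    simp [Function.IsFixedPt, ha, hr.map_root]
  · intro y hy
    -- Since `5` is prime and the fifth power of the rotation is the identity, a vertex that is not
    -- fixed has period exactly `5`.
    have : Fact (Nat.Prime 5) := ⟨by norm_num⟩
    rw [hroot]
    refine Function.minimalPeriod_eq_prime ?_ ?_
    · simp [Function.IsPeriodicPt, Function.IsFixedPt, ha, hr.iter_vertex]
    · intro hfix
      refine hy ?_
      rw [← Equiv.symm_apply_eq]
      refine hr.eq_root _ ?_
      rw [Equiv.eq_symm_apply]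
      exact hfix

end represents

/-- The underlying multigraph of `G`, in any universes. -/
def toGraph {V E : Type} (G : OGraph V E) : Graph (ULift.{u} V) (ULift.{v} E) where
  vertexSet := Set.univ
  edgeSet := Set.univ
  IsLink e x y := G.Joins e.down x.down y.down
  isLink_symm _ _ := ⟨fun _ _ h ↦ h.symm⟩
  eq_or_eq_of_isLink_of_isLink := by
    rintro e x y v w (⟨h1, h2⟩ | ⟨h1, h2⟩) (⟨h3, h4⟩ | ⟨h3, h4⟩)
    · exact .inl (ULift.down_injective (h1.symm.trans h3))
    · exact .inr (ULift.down_injective (h1.symm.trans h3))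
    · exact .inr (ULift.down_injective (h2.symm.trans h4))
    · exact .inl (ULift.down_injective (h2.symm.trans h4))
  edge_mem_iff_exists_isLink e :=
    iff_of_true trivial ⟨⟨G.s e.down⟩, ⟨G.t e.down⟩, .inl ⟨rfl, rfl⟩⟩
  left_mem_of_isLink _ _ _ _ := trivial

theorem represents_toGraph {V E : Type} (G : OGraph V E) :
    G.Represents (toGraph.{u, v} G) (Equiv.ulift.symm.trans (Equiv.Set.univ _).symm)
      (Equiv.ulift.symm.trans (Equiv.Set.univ _).symm) :=
  fun _ ↦ .inl ⟨rfl, rfl⟩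

theorem exists_represents {α : Type u} {β : Type v} {H : Graph α β}
    (hH : H.IsRegularMultigraph 5) : ∃ (n m : ℕ) (G : OGraph (Fin n) (Fin m))
      (φ : Fin n ≃ H.vertexSet) (ψ : Fin m ≃ H.edgeSet), G.Represents H φ ψ := by
  have := hH.finite_vertexSet.to_subtype
  have := hH.finite_edgeSet.to_subtype
  have := hH.loopless
  have φ := (Finite.equivFin H.vertexSet).symm
  have ψ := (Finite.equivFin H.edgeSet).symm
  have h : ∀ e, ∃ u v, H.IsLink (ψ e) (φ u) (φ v) := by
    intro e
    obtain ⟨y, z, hyz⟩ := Graph.exists_isLink_of_mem_edgeSet (ψ e).2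
    exact ⟨φ.symm ⟨y, hyz.left_mem⟩, φ.symm ⟨z, hyz.right_mem⟩, by
      rwa [φ.apply_symm_apply, φ.apply_symm_apply]⟩
  choose s t hst using h
  exact ⟨_, _, ⟨s, t, fun e he ↦ (hst e).ne (by rw [he])⟩, φ, ψ, hst⟩

end OGraph

/-! ### Reduction to connected graphs. -/

namespace OGraph

section components

variable {V E : Type} (G : OGraph V E)

/-- The subgraph formed by the vertices `v` with `c v = k`, where `c` is constant on edges. -/
def fiber {K : Type} (c : V → K) (hc : ∀ e, c (G.s e) = c (G.t e)) (k : K) :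
    OGraph {v // c v = k} {e // c (G.s e) = k} where
  s e := ⟨G.s e, e.2⟩
  t e := ⟨G.t e, (hc e).symm.trans e.2⟩
  ne e h := G.ne e (congrArg Subtype.val h)

variable {G} [Fintype V] [Fintype E] [DecidableEq V] [DecidableEq E]
  {K : Type} [DecidableEq K] {c : V → K} {hc : ∀ e, c (G.s e) = c (G.t e)} {k : K}

theorem sum_fiber {M : Type} [AddCommMonoid M] (f : E → M) (p : E → Prop) [DecidablePred p]
    (hp : ∀ e, p e → c (G.s e) = k) :
    (∑ e : {e // c (G.s e) = k}, if p e then f e else 0) = ∑ e, if p e then f e else 0 := by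
  rw [← Finset.sum_filter_add_sum_filter_not Finset.univ (fun e ↦ c (G.s e) = k)
    (fun e ↦ if p e then f e else 0), Finset.sum_eq_zero (s := Finset.univ.filter
    (fun e ↦ ¬ c (G.s e) = k)), add_zero]
  · exact (Finset.sum_subtype (Finset.univ.filter fun e ↦ c (G.s e) = k) (by simp)
      (fun e ↦ if p e then f e else 0)).symm
  · intro e he
    rw [if_neg]
    exact fun h ↦ (Finset.mem_filter.1 he).2 (hp e h)

theorem fiber_outSum {M : Type} [AddCommMonoid M] (f : E → M) (v : {v // c v = k}) :
    (G.fiber c hc k).outSum (fun e ↦ f e) v = G.outSum f v := by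
  rw [outSum, outSum, ← sum_fiber (G := G) (c := c) (k := k) f (G.s · = v)]
  · refine Finset.sum_congr rfl fun e _ ↦ ?_
    simp [fiber, Subtype.ext_iff]
  · intro e he
    rw [he]
    exact v.2

theorem fiber_inSum {M : Type} [AddCommMonoid M] (f : E → M) (v : {v // c v = k}) :
    (G.fiber c hc k).inSum (fun e ↦ f e) v = G.inSum f v := by
  rw [inSum, inSum, ← sum_fiber (G := G) (c := c) (k := k) f (G.t · = v)]
  · refine Finset.sum_congr rfl fun e _ ↦ ?_
    simp [fiber, Subtype.ext_iff]
  · intro e he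
    rw [hc, he]
    exact v.2

theorem IsFive.fiber (h : G.IsFive) : (G.fiber c hc k).IsFive where
  regular v := by
    have := h.regular v.1
    rwa [← fiber_outSum (hc := hc) _ v, ← fiber_inSum (hc := hc) _ v] at this
  le_cut S hS := by
    let S' : V → Bool := fun v ↦ if hv : c v = k then S ⟨v, hv⟩ else false
    have h1 : supp S' = (supp S).map (Function.Embedding.subtype _) := by
      ext v
      simp [supp, S']
    have h2 : G.cut S' = ((G.fiber c hc k).cut S).map (Function.Embedding.subtype _) := by
      ext e
      by_cases he : c (G.s e) = k
      · simp [mem_cut, S', he, ← hc, OGraph.fiber]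
      · simp [mem_cut, S', he, ← hc]
    have h3 := h.le_cut S' (by rwa [h1, Finset.card_map])
    rwa [h2, Finset.card_map] at h3

theorem HasFlow.of_fibers (h : ∀ k, (G.fiber c hc k).HasFlow) : G.HasFlow := by
  choose f h0 hf using h
  refine ⟨fun e ↦ f _ ⟨e, rfl⟩, fun e ↦ h0 _ _, fun v ↦ ?_⟩
  have h1 := hf (c v) ⟨v, rfl⟩
  have h2 : ∀ k, f k = fun e : {e // c (G.s e) = k} ↦ f (c (G.s e)) ⟨e, rfl⟩ := by
    intro k
    ext ⟨e, rfl⟩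
    rfl
  rw [h2] at h1
  exact (fiber_outSum (hc := hc) (fun e ↦ f (c (G.s e)) ⟨e, rfl⟩) ⟨v, rfl⟩).symm.trans
    (h1.trans (fiber_inSum (hc := hc) (fun e ↦ f (c (G.s e)) ⟨e, rfl⟩) ⟨v, rfl⟩))

end components

variable {V E : Type} [Fintype V] [Fintype E] [DecidableEq V] [DecidableEq E] {G : OGraph V E}

/-- The components are the fibres of the quotient of `V` by adjacency; flows on them combine.
Connectedness is expressed by predicates constant along edges, so a predicate on one component is
extended by `False` to `V` and descends to the quotient. -/
theorem hasFlow_of_connected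
    (h : ∀ (W F : Type) [Fintype W] [Fintype F] [DecidableEq W] [DecidableEq F] (Q : OGraph W F),
      Q.IsFive → (∀ P : W → Prop, (∀ e, P (Q.s e) ↔ P (Q.t e)) → ∀ u v, P u → P v) → Q.HasFlow)
    (hG : G.IsFive) : G.HasFlow := by
  classical
  let r : V → V → Prop := fun u v ↦ ∃ e, G.s e = u ∧ G.t e = v
  have hc : ∀ e, Quot.mk r (G.s e) = Quot.mk r (G.t e) := fun e ↦ Quot.sound ⟨e, rfl, rfl⟩
  refine HasFlow.of_fibers (hc := hc) fun k ↦ h _ _ _ hG.fiber fun P hP u v hu ↦ ?_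
  let P' : V → Prop := fun v ↦ ∃ hv : Quot.mk r v = k, P ⟨v, hv⟩
  have hP' : ∀ u v, r u v → P' u = P' v := by
    rintro _ _ ⟨e, rfl, rfl⟩
    refine propext ⟨?_, ?_⟩
    · rintro ⟨h1, h2⟩
      exact ⟨(hc e).symm.trans h1, (hP ⟨e, h1⟩).1 h2⟩
    · rintro ⟨h1, h2⟩
      exact ⟨(hc e).trans h1, (hP ⟨e, (hc e).trans h1⟩).2 h2⟩
  have h1 : Quot.lift P' hP' (Quot.mk r u.1) = Quot.lift P' hP' (Quot.mk r v.1) :=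
    congrArg _ (u.2.trans v.2.symm)
  have h2 : P' v := h1.mp ⟨u.2, hu⟩
  exact h2.2

end OGraph

/-! ### The equivalence. -/

open OGraph in
theorem mainTheorem6 :
    (∀ (α : Type u) (β : Type v) (G : Graph α β), G.IsRGraph 5 → G.HasNowhereZeroFlow 3) ↔
      (∀ (α : Type u) (β : Type v) (G : Graph α β),
        G.Simple → G.IsRotationRGraph 5 → G.HasNowhereZeroFlow 3) := by
  refine ⟨fun h α β G _ hG ↦ h α β G hG.1, fun h α β H hH ↦ ?_⟩
  obtain ⟨n, m, G, φ, ψ, hG⟩ := exists_represents hH.toIsRegularMultigraph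
  refine hG.hasNowhereZeroFlow (hasFlow_of_connected ?_ (hG.isRGraph_iff.1 hH))
  intro W F _ _ _ _ Q hQ hc
  -- Without edges there is no `e₀` to remove, but the flow is trivial.
  rcases isEmpty_or_nonempty F with hF | ⟨⟨e₀⟩⟩
  · exact ⟨fun _ ↦ 1, fun e ↦ hF.elim e, fun v ↦ by simp [outSum, inSum]⟩
  obtain ⟨M, hM⟩ := hQ.exists_isStage_of_connected e₀ hc
  obtain ⟨V, E, _, _, _, _, G', x, σ, τ, d, D, h5, hr, hl, hP⟩ :=
    (hM.of_zero M).exists_isTreeLayered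
  have hrep := represents_toGraph.{u, v} G'
  exact hP (hrep.hasFlow (h _ _ _ (hrep.simple hl.eq_of_parallel)
    (hrep.isRotationRGraph h5 hr hl)))
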